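/- Let $m\ge 3$ be an integer and $\omega=\exp\left[\frac{2\pi i}{m+2}\right]$. All non-integer powers are principal: $\arg z^{\alpha}=\alpha\arg z$ with $-\pi<\arg z\le\pi$. Let $f(z,\lambda)$ be the normalized subdominant solution of $$-v''(z)+\left[z^m+\lambda\right]v(z)=0,\qquad \lambda\in\mathbb C,$$ that is, the unique entire function of $(z,\lambda)\in\mathbb C^2$ that solves this equation in $z$ for every $\lambda$ and satisfies, for every $\epsilon>0$, $$f(z,\lambda)=z^{-\frac m4}\left(1+O(z^{-1/2})\right)\exp\left[-\tfrac{2}{m+2}z^{\frac{m+2}{2}}\right],\qquad f'(z,\lambda)=-z^{\frac m4}\left(1+O(z^{-1/2})\right)\exp\left[-\tfrac{2}{m+2}z^{\frac{m+2}{2}}\right]$$ as $z\to\infty$ in the sector $|\arg z|\le\frac{3\pi}{m+2}-\epsilon$, uniformly for $\lambda$ in each compact subset of $\mathbb C$, where $'$ denotes $\frac{d}{dz}$. For $j,k\in\mathbb Z$ put $$f_k(z,\lambda)=f(\omega^{-k}z,\omega^{-mk}\lambda),\qquad W_{j,k}=f_jf_k'-f_j'f_k .$$ Then for every $k\in\mathbb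 Z$ and all $z,\lambda\in\mathbb C$ the Wronskian satisfies $$W_{k,k+1}(\lambda)=f_k(z,\lambda)f_{k+1}'(z,\lambda)-f_k'(z,\lambda)f_{k+1}(z,\lambda)=-2\,\omega^{-\frac m4-k-1};$$ in particular $W_{k,k+1}$ does not depend on $z$ or on $\lambda$. -/

import Mathlib

noncomputable section

namespace Subdominant

/-- The root of unity `ω = exp (2πi / (m + 2))`. -/
def omega (m : ℕ) : ℂ :=
  Complex.exp (2 * (Real.pi : ℂ) * Complex.I / ((m : ℂ) + 2))

/-- The exponential factor `exp (-(2 / (m + 2)) z ^ ((m + 2) / 2))`, principal branch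
(`-π < arg z ≤ π`). -/
def expFactor (m : ℕ) (z : ℂ) : ℂ :=
  Complex.exp (-(2 / ((m : ℂ) + 2)) * z ^ (((m : ℂ) + 2) / 2))

/-- `f (z, lam)` is the normalized subdominant solution of `-v'' + (z ^ m + lam) v = 0`: it is an
entire function of the pair `(z, lam)`, it solves the equation in `z` for every `lam`, and
`f = z ^ (-m/4) (1 + O(z ^ (-1/2))) exp (-(2/(m+2)) z ^ ((m+2)/2))`,
`f' = -z ^ (m/4) (1 + O(z ^ (-1/2))) exp (-(2/(m+2)) z ^ ((m+2)/2))`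
as `z → ∞` in `|arg z| ≤ 3π/(m+2) - ε`, for every `ε > 0`, uniformly for `lam` in compact sets.
All powers of `z` are principal. -/
structure IsSubdominantSolution (m : ℕ) (f : ℂ → ℂ → ℂ) : Prop where
  entire : Differentiable ℂ (fun p : ℂ × ℂ => f p.1 p.2)
  ode : ∀ lam z : ℂ,
    -deriv (deriv (fun w => f w lam)) z + (z ^ m + lam) * f z lam = 0
  asymp : ∀ ε : ℝ, 0 < ε → ∀ K : Set ℂ, IsCompact K →
    ∃ C R : ℝ, 0 < R ∧ ∀ lam ∈ K, ∀ z : ℂ, R ≤ ‖z‖ →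
      |Complex.arg z| ≤ 3 * Real.pi / ((m : ℝ) + 2) - ε →
        ‖f z lam / (z ^ (-(m : ℂ) / 4) * expFactor m z) - 1‖ ≤ C * ‖z‖ ^ (-(1 / 2) : ℝ)
  asymp_deriv : ∀ ε : ℝ, 0 < ε → ∀ K : Set ℂ, IsCompact K →
    ∃ C R : ℝ, 0 < R ∧ ∀ lam ∈ K, ∀ z : ℂ, R ≤ ‖z‖ →
      |Complex.arg z| ≤ 3 * Real.pi / ((m : ℝ) + 2) - ε →
        ‖deriv (fun w => f w lam) z / (-(z ^ ((m : ℂ) / 4)) * expFactor m z) - 1‖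
          ≤ C * ‖z‖ ^ (-(1 / 2) : ℝ)

/-- The normalized subdominant solution `f (z, lam)`, picked out by the properties that determine
it. Its existence is not built in: if there were no such function, this would be an unspecified
function. -/
def sol (m : ℕ) : ℂ → ℂ → ℂ :=
  Classical.epsilon (IsSubdominantSolution m)

/-- The rotated solutions `f_k (z, lam) = f (ω ^ (-k) z, ω ^ (-m k) lam)`, `k ∈ ℤ`. -/
def rotSol (m : ℕ) (k : ℤ) (z lam : ℂ) : ℂ :=
  sol m (omega m ^ (-k) * z) (omega m ^ (-(m : ℤ) * k) * lam)

/-- The Wronskian `W_{j,k} = f_j f_k' - f_j' f_k` (derivatives in `z`), evaluated at `z`. -/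
def wronskian (m : ℕ) (j k : ℤ) (z lam : ℂ) : ℂ :=
  rotSol m j z lam * deriv (fun w => rotSol m k w lam) z
    - deriv (fun w => rotSol m j w lam) z * rotSol m k z lam

end Subdominant

end

/-!
The Wronskian itself is a short computation: two solutions of `v'' = (z ^ m + lam) v` have constant
Wronskian, rotating `z` by `ω` and `lam` by `ω ^ m` preserves the equation, and on the ray
`arg z = π / (m + 2)` both `f (z, lam)` and `f (ω⁻¹ z, ω⁻ᵐ lam)` are in the sector where the
asymptotics hold. There the exponential factors cancel and the powers of `z` combine to
`-ω⁻¹ q⁻¹ + q` with `q = ω ^ (m / 4)`, and `q ^ 2 = -ω⁻¹`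
(`IsSubdominantSolution.wronskian_neighbour`).

Since `sol` is a choice, the substance is the existence of the subdominant solution
(`exists_isSubdominantSolution`). Write `z = exp w`, let `S = 2 / (m + 2) * z ^ ((m + 2) / 2)`, and
split a solution into amplitudes `P`, `R` of the decaying and the growing WKB solution. They satisfy
`P' = -G (P + R) / 2` and `R' = 2 S' R + G (P + R) / 2`, where `G = O(exp (-Re w / 2))` because
`m ≥ 3`. Along a path on which `Re S` decreases the term `2 S' R` only damps `R`, so the deviation
of `(P, R)` from `(1, 0)` grows at most by the factor `exp (∫ ‖G‖)` (`dev_gronwall`).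

Starting with `(P, R) = (1, 0)` at `z = exp N` and coming down the real axis, this shows that the
solutions so obtained are a Cauchy sequence as `N → ∞`, locally uniformly in `lam`. Expressed in a
fundamental system that is entire in `(z, lam)`, given by power series, their coordinates converge
to entire functions of `lam`, and the limit is `f` (`exists_sol_real`). The same estimate carries
the asymptotics from the real axis into the sector: along arcs `|z| = const` up to
`|arg z| = 2 π / (m + 2)`, and along logarithmic spirals beyond, which are segments in the variable
`w` (`exists_sector_bound`).
-/

open Filter Topology

noncomputable section

namespace Subdominant

/-! ### Power series in `z` with entire coefficients -/

/-- A locally uniformly (Weierstrass) dominated series of entire functions on a complex normed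
space is entire. The derivatives of the terms are controlled by Cauchy's estimate on complex
lines. -/
lemma differentiable_tsum_of_locally_bounded {E : Type*} [NormedAddCommGroup E] [NormedSpace ℂ E]
    {F : ℕ → E → ℂ} (hF : ∀ n, Differentiable ℂ (F n))
    (hb : ∀ L : ℝ, ∃ u : ℕ → ℝ, Summable u ∧ ∀ n p, ‖p‖ ≤ L → ‖F n p‖ ≤ u n) :
    Differentiable ℂ fun p => ∑' n, F n p := by
  intro p
  obtain ⟨u, hu, hFu⟩ := hb (‖p‖ + 2)
  have hu0 : ∀ n, 0 ≤ u n := fun n => (norm_nonneg _).trans (hFu n p (by linarith))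
  refine (hasFDerivAt_tsum_of_isPreconnected (u := u) (f := F) (f' := fun n q => fderiv ℂ (F n) q)
    (s := Metric.ball 0 (‖p‖ + 1)) (x₀ := p) hu Metric.isOpen_ball
    (convex_ball _ _).isPreconnected (fun n x _ => (hF n x).hasFDerivAt) ?_ (by simp) ?_
    (by simp)).differentiableAt
  · intro n q hq
    have hq' : ‖q‖ < ‖p‖ + 1 := by simpa using hq
    refine ContinuousLinearMap.opNorm_le_of_unit_norm (𝕜 := ℝ)
      (f := (fderiv ℂ (F n) q).restrictScalars ℝ) (hu0 n) fun v hv => ?_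
    have hline : ∀ t : ℂ, HasDerivAt (fun t : ℂ => q + t • v) v t := fun t => by
      simpa using ((hasDerivAt_id t).smul_const v).const_add q
    have hd : HasDerivAt (fun t : ℂ => F n (q + t • v)) (fderiv ℂ (F n) q v) 0 := by
      have h0 : HasFDerivAt (F n) (fderiv ℂ (F n) q) (q + (0 : ℂ) • v) := by
        simpa using (hF n q).hasFDerivAt
      exact h0.comp_hasDerivAt 0 (hline 0)
    have hdiff : Differentiable ℂ (fun t : ℂ => F n (q + t • v)) := fun t =>
      (hF n _).comp t (hline t).differentiableAt
    have := Complex.norm_deriv_le_of_forall_mem_sphere_norm_le (c := 0) (R := 1) (C := u n)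
      one_pos hdiff.diffContOnCl (fun t ht => hFu n _ ?_)
    · rw [hd.deriv] at this
      simpa using this
    · have ht' : ‖t‖ = 1 := by simpa using ht
      calc ‖q + t • v‖ ≤ ‖q‖ + ‖t • v‖ := norm_add_le _ _
        _ ≤ ‖p‖ + 2 := by rw [norm_smul, ht', hv]; linarith
  · exact Summable.of_norm_bounded hu fun n => hFu n p (by linarith)

/-- Coefficients `a n : ℂ → ℂ` that are entire and decay faster than any geometric sequence,
uniformly on bounded sets; these are the coefficients of power series `∑ a n lam * z ^ n` that are
entire in `(z, lam)`. -/
structure RapidDecay (a : ℕ → ℂ → ℂ) : Prop where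
  differentiable : ∀ n, Differentiable ℂ (a n)
  bound : ∀ L ρ : ℝ, 0 < ρ → ∃ C : ℝ, 0 ≤ C ∧ ∀ n lam, ‖lam‖ ≤ L → ‖a n lam‖ ≤ C * ρ ^ n

/-- The sum of the power series in `z` with coefficients `a n lam`. -/
def powSeries (a : ℕ → ℂ → ℂ) (z lam : ℂ) : ℂ := ∑' n, a n lam * z ^ n

/-- The coefficients of the termwise derivative in `z`. -/
def derivCoeff (a : ℕ → ℂ → ℂ) (n : ℕ) (lam : ℂ) : ℂ := ((n : ℂ) + 1) * a (n + 1) lam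

lemma RapidDecay.derivCoeff {a : ℕ → ℂ → ℂ} (ha : RapidDecay a) : RapidDecay (derivCoeff a) where
  differentiable n := (ha.differentiable (n + 1)).const_mul _
  bound L ρ hρ := by
    obtain ⟨C, hC, h⟩ := ha.bound L (ρ / 2) (by positivity)
    refine ⟨C * ρ, by positivity, fun n lam hlam => ?_⟩
    have h1 := h (n + 1) lam hlam
    have h2 : ((n : ℝ) + 1) ≤ 2 ^ (n + 1) := by exact_mod_cast (Nat.lt_two_pow_self (n := n + 1)).le
    have h3 : ‖(n : ℂ) + 1‖ = (n : ℝ) + 1 := by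
      rw [← Nat.cast_succ, Complex.norm_natCast]; push_cast; ring
    rw [Subdominant.derivCoeff, norm_mul, h3]
    calc ((n : ℝ) + 1) * ‖a (n + 1) lam‖ ≤ 2 ^ (n + 1) * (C * (ρ / 2) ^ (n + 1)) := by gcongr
      _ = C * ρ * ρ ^ n := by rw [div_pow, pow_succ ρ]; field_simp

/-- On `‖z‖ ≤ L`, `‖lam‖ ≤ L` the terms are dominated by a geometric series. -/
lemma RapidDecay.exists_bound_term {a : ℕ → ℂ → ℂ} (ha : RapidDecay a) (L : ℝ) :
    ∃ u : ℕ → ℝ, Summable u ∧ ∀ n z lam, ‖z‖ ≤ L → ‖lam‖ ≤ L → ‖a n lam * z ^ n‖ ≤ u n := by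
  obtain ⟨C, hC, h⟩ := ha.bound L (1 / (2 * (|L| + 1))) (by positivity)
  refine ⟨fun n => C * (1 / 2) ^ n, (summable_geometric_two).mul_left C,
    fun n z lam hz hlam => ?_⟩
  rw [norm_mul, norm_pow]
  calc ‖a n lam‖ * ‖z‖ ^ n ≤ (C * (1 / (2 * (|L| + 1))) ^ n) * (|L| + 1) ^ n := by
        gcongr
        · exact h n lam hlam
        · linarith [le_abs_self L]
    _ = C * (1 / 2) ^ n := by
        rw [mul_assoc, ← mul_pow]; congr 2; field_simp

lemma RapidDecay.summable {a : ℕ → ℂ → ℂ} (ha : RapidDecay a) (z lam : ℂ) :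
    Summable fun n => a n lam * z ^ n := by
  obtain ⟨u, hu, h⟩ := ha.exists_bound_term (max ‖z‖ ‖lam‖)
  exact Summable.of_norm_bounded hu fun n => h n z lam (le_max_left _ _) (le_max_right _ _)

lemma RapidDecay.differentiable_powSeries {a : ℕ → ℂ → ℂ} (ha : RapidDecay a) :
    Differentiable ℂ fun p : ℂ × ℂ => powSeries a p.1 p.2 := by
  refine differentiable_tsum_of_locally_bounded
    (F := fun n (p : ℂ × ℂ) => a n p.2 * p.1 ^ n) (fun n => ?_) fun L => ?_
  · exact ((ha.differentiable n).comp differentiable_snd).mul (differentiable_fst.pow n)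
  · obtain ⟨u, hu, h⟩ := ha.exists_bound_term L
    exact ⟨u, hu, fun n p hp => h n p.1 p.2 ((norm_fst_le p).trans hp) ((norm_snd_le p).trans hp)⟩

lemma RapidDecay.hasDerivAt_powSeries {a : ℕ → ℂ → ℂ} (ha : RapidDecay a) (z lam : ℂ) :
    HasDerivAt (fun w => powSeries a w lam) (powSeries (Subdominant.derivCoeff a) z lam) z := by
  obtain ⟨u, hu, h⟩ := ha.derivCoeff.exists_bound_term (max (‖z‖ + 1) ‖lam‖)
  have hsplit : ∀ w, powSeries a w lam = a 0 lam + ∑' n, a (n + 1) lam * w ^ (n + 1) := fun w => by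
    simp only [powSeries]
    rw [(ha.summable w lam).tsum_eq_zero_add]
    simp
  rw [show (fun w => powSeries a w lam) = _ from funext hsplit]
  refine HasDerivAt.const_add _ ?_
  refine hasDerivAt_tsum_of_isPreconnected (u := u) (t := Metric.ball 0 (‖z‖ + 1)) (y₀ := z)
    (g := fun n w => a (n + 1) lam * w ^ (n + 1))
    (g' := fun n w => Subdominant.derivCoeff a n lam * w ^ n) hu
    Metric.isOpen_ball (convex_ball _ _).isPreconnected (fun n w _ => ?_) (fun n w hw => ?_)
    (by simp) ?_ (by simp)
  · refine ((hasDerivAt_pow (n + 1) w).const_mul (a (n + 1) lam)).congr_deriv ?_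
    simp [Subdominant.derivCoeff]; ring
  · have : ‖w‖ < ‖z‖ + 1 := by simpa using hw
    exact h n w lam (this.le.trans (le_max_left _ _)) (le_max_right _ _)
  · exact (summable_nat_add_iff (f := fun n => a n lam * z ^ n) 1).2 (ha.summable z lam)

/-! ### Entire solutions depending holomorphically on the parameter -/

/-- `y` is an entire solution of `y'' = (z ^ m + lam) y`, and `y'` is its derivative. -/
def IsSol (m : ℕ) (lam : ℂ) (y y' : ℂ → ℂ) : Prop :=
  ∀ z, HasDerivAt y (y' z) z ∧ HasDerivAt y' ((z ^ m + lam) * y z) z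

lemma IsSol.lin {m : ℕ} {lam : ℂ} {y₁ y₁' y₂ y₂' : ℂ → ℂ} (h₁ : IsSol m lam y₁ y₁')
    (h₂ : IsSol m lam y₂ y₂') (α β : ℂ) :
    IsSol m lam (fun z => α * y₁ z + β * y₂ z) (fun z => α * y₁' z + β * y₂' z) := fun z =>
  ⟨((h₁ z).1.const_mul α).add ((h₂ z).1.const_mul β),
    (((h₁ z).2.const_mul α).add ((h₂ z).2.const_mul β)).congr_deriv (by ring)⟩

lemma IsSol.wronskian_const {m : ℕ} {lam : ℂ} {y₁ y₁' y₂ y₂' : ℂ → ℂ} (h₁ : IsSol m lam y₁ y₁')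
    (h₂ : IsSol m lam y₂ y₂') (z w : ℂ) :
    y₁ z * y₂' z - y₁' z * y₂ z = y₁ w * y₂' w - y₁' w * y₂ w := by
  have hd : ∀ z, HasDerivAt (fun z => y₁ z * y₂' z - y₁' z * y₂ z) 0 z := fun z =>
    (((h₁ z).1.mul (h₂ z).2).sub ((h₁ z).2.mul (h₂ z).1)).congr_deriv (by ring)
  exact is_const_of_deriv_eq_zero (fun z => (hd z).differentiableAt) (fun z => (hd z).deriv) z w

/-- Taylor coefficients at `z = 0` of the solution of `y'' = (z ^ m + lam) y` with `y 0 = u` and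
`y' 0 = v`. -/
def solCoeff (m : ℕ) (u v : ℂ) : ℕ → ℂ → ℂ
  | 0 => fun _ => u
  | 1 => fun _ => v
  | n + 2 => fun lam =>
      (lam * solCoeff m u v n lam + if m ≤ n then solCoeff m u v (n - m) lam else 0)
        / (((n : ℂ) + 2) * ((n : ℂ) + 1))
  decreasing_by all_goals omega

lemma differentiable_solCoeff (m : ℕ) (u v : ℂ) (n : ℕ) : Differentiable ℂ (solCoeff m u v n) := by
  induction n using Nat.strong_induction_on with
  | _ n ih =>
    match n with
    | 0 => simp only [solCoeff]; fun_prop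
    | 1 => simp only [solCoeff]; fun_prop
    | n + 2 =>
      have h1 := ih n (by omega)
      have h2 := ih (n - m) (by omega)
      simp only [solCoeff]
      split_ifs <;> fun_prop

/-- Once `(n + 2) (n + 1)` exceeds `L / ρ ^ 2 + 1 / ρ ^ (m + 2)`, the recurrence propagates a bound
`C * ρ ^ n`; the finitely many earlier coefficients are bounded by compactness. -/
lemma rapidDecay_solCoeff (m : ℕ) (u v : ℂ) : RapidDecay (solCoeff m u v) where
  differentiable := differentiable_solCoeff m u v
  bound L ρ hρ := by
    have hfin : ∀ n, ∃ c : ℝ, 0 ≤ c ∧ ∀ lam, ‖lam‖ ≤ L → ‖solCoeff m u v n lam‖ ≤ c * ρ ^ n := by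
      intro n
      obtain ⟨c, hc⟩ := (isCompact_closedBall (0 : ℂ) L).exists_bound_of_continuousOn
        (differentiable_solCoeff m u v n).continuous.continuousOn
      refine ⟨|c| / ρ ^ n, by positivity, fun lam hlam => ?_⟩
      rw [div_mul_cancel₀ _ (by positivity)]
      exact (hc lam (by simpa using hlam)).trans (le_abs_self c)
    choose c hc0 hc using hfin
    obtain ⟨N, hN⟩ := exists_nat_ge (|L| / ρ ^ 2 + 1 / ρ ^ (m + 2))
    have hS0 : 0 ≤ ∑ k ∈ Finset.range (N + 2), c k := Finset.sum_nonneg fun k _ => hc0 k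
    refine ⟨∑ k ∈ Finset.range (N + 2), c k, hS0, fun n lam hlam => ?_⟩
    set S := ∑ k ∈ Finset.range (N + 2), c k with hS
    induction n using Nat.strong_induction_on with
    | _ n ih =>
      by_cases hn : n < N + 2
      · refine (hc n lam hlam).trans ?_
        gcongr
        exact Finset.single_le_sum (fun k _ => hc0 k) (Finset.mem_range.2 hn)
      · obtain ⟨n, rfl⟩ : ∃ k, n = k + 2 := ⟨n - 2, by omega⟩
        have hNn : (N : ℝ) ≤ n := by exact_mod_cast (by omega : N ≤ n)
        have hnorm : ‖((n : ℂ) + 2) * ((n : ℂ) + 1)‖ = ((n : ℝ) + 2) * (n + 1) := by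
          rw [norm_mul]
          congr 1
          · exact_mod_cast Complex.norm_natCast (n + 2)
          · exact_mod_cast Complex.norm_natCast (n + 1)
        simp only [solCoeff]
        rw [norm_div, hnorm, div_le_iff₀ (by positivity)]
        have h1 : ‖lam * solCoeff m u v n lam‖ ≤ |L| / ρ ^ 2 * (S * ρ ^ (n + 2)) := by
          rw [norm_mul]
          calc ‖lam‖ * ‖solCoeff m u v n lam‖ ≤ |L| * (S * ρ ^ n) := by
                gcongr
                · exact hlam.trans (le_abs_self L)
                · exact ih n (by omega)
            _ = |L| / ρ ^ 2 * (S * ρ ^ (n + 2)) := by rw [pow_add]; field_simp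
        have h2 : ‖if m ≤ n then solCoeff m u v (n - m) lam else 0‖
            ≤ 1 / ρ ^ (m + 2) * (S * ρ ^ (n + 2)) := by
          split_ifs with hmn
          · refine (ih (n - m) (by omega)).trans (le_of_eq ?_)
            have : ρ ^ (n + 2) = ρ ^ (n - m) * ρ ^ (m + 2) := by rw [← pow_add]; congr 1; omega
            rw [this]; field_simp
          · rw [norm_zero]; positivity
        calc _ ≤ |L| / ρ ^ 2 * (S * ρ ^ (n + 2)) + 1 / ρ ^ (m + 2) * (S * ρ ^ (n + 2)) :=
              (norm_add_le _ _).trans (add_le_add h1 h2)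
          _ = S * ρ ^ (n + 2) * (|L| / ρ ^ 2 + 1 / ρ ^ (m + 2)) := by ring
          _ ≤ S * ρ ^ (n + 2) * (((n : ℝ) + 2) * (n + 1)) := by
              gcongr
              nlinarith

lemma isSol_powSeries (m : ℕ) (u v lam : ℂ) :
    IsSol m lam (fun z => powSeries (solCoeff m u v) z lam)
      (fun z => powSeries (derivCoeff (solCoeff m u v)) z lam) := by
  have ha := rapidDecay_solCoeff m u v
  intro z
  refine ⟨ha.hasDerivAt_powSeries z lam, ?_⟩
  convert ha.derivCoeff.hasDerivAt_powSeries z lam using 1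
  have hterm : ∀ n, derivCoeff (derivCoeff (solCoeff m u v)) n lam * z ^ n
      = lam * (solCoeff m u v n lam * z ^ n)
        + if m ≤ n then solCoeff m u v (n - m) lam * z ^ n else 0 := fun n => by
    have h1 : (n : ℂ) + 1 ≠ 0 := by exact_mod_cast n.succ_ne_zero
    have h2 : (n : ℂ) + 2 ≠ 0 := by exact_mod_cast (n + 1).succ_ne_zero
    have h3 : ((n : ℂ) + 1 + 1) = n + 2 := by ring
    simp only [derivCoeff, solCoeff]
    push_cast
    rw [h3]
    split_ifs <;> field_simp
    ring
  have hs := ha.summable z lam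
  -- the terms with `n < m` vanish, so the second part is a shifted copy of the series times `z ^ m`
  have hshift : HasSum (fun n => if m ≤ n then solCoeff m u v (n - m) lam * z ^ n else 0)
      (z ^ m * powSeries (solCoeff m u v) z lam) := by
    rw [← hasSum_nat_add_iff' m, Finset.sum_eq_zero, sub_zero]
    · refine (hs.hasSum.mul_left (z ^ m)).congr_fun fun n => ?_
      rw [if_pos (by omega), Nat.add_sub_cancel, pow_add]; ring
    · intro i hi
      rw [if_neg (by simpa using hi)]
  conv_rhs => simp only [powSeries, hterm]
  rw [((hs.hasSum.mul_left lam).add hshift).tsum_eq]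
  simp only [powSeries]; ring

/-- A system of two solutions, entire in `(z, lam)` together with their `z`-derivatives, with
Wronskian `1`. -/
structure IsFundamental (m : ℕ) (y₁ y₁' y₂ y₂' : ℂ → ℂ → ℂ) : Prop where
  diff₁ : Differentiable ℂ fun p : ℂ × ℂ => y₁ p.1 p.2
  diff₁' : Differentiable ℂ fun p : ℂ × ℂ => y₁' p.1 p.2
  diff₂ : Differentiable ℂ fun p : ℂ × ℂ => y₂ p.1 p.2
  diff₂' : Differentiable ℂ fun p : ℂ × ℂ => y₂' p.1 p.2
  sol₁ : ∀ lam, IsSol m lam (fun z => y₁ z lam) (fun z => y₁' z lam)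
  sol₂ : ∀ lam, IsSol m lam (fun z => y₂ z lam) (fun z => y₂' z lam)
  wronskian : ∀ z lam, y₁ z lam * y₂' z lam - y₁' z lam * y₂ z lam = 1

lemma exists_isFundamental (m : ℕ) : ∃ y₁ y₁' y₂ y₂', IsFundamental m y₁ y₁' y₂ y₂' := by
  have h0 : ∀ a lam, powSeries a 0 lam = a 0 lam := fun a lam => by
    rw [powSeries, tsum_eq_single 0 fun n hn => by simp [hn]]; simp
  refine ⟨_, _, _, _, (rapidDecay_solCoeff m 1 0).differentiable_powSeries,
    (rapidDecay_solCoeff m 1 0).derivCoeff.differentiable_powSeries,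
    (rapidDecay_solCoeff m 0 1).differentiable_powSeries,
    (rapidDecay_solCoeff m 0 1).derivCoeff.differentiable_powSeries,
    isSol_powSeries m 1 0, isSol_powSeries m 0 1, fun z lam => ?_⟩
  rw [(isSol_powSeries m 1 0 lam).wronskian_const (isSol_powSeries m 0 1 lam) z 0]
  simp [h0, derivCoeff, solCoeff]

/-! ### A Grönwall estimate for the amplitudes -/

/-- The Euclidean distance of the pair of amplitudes `(P, R)` from `(c, 0)`. -/
def dev (P R c : ℂ) : ℝ := √(‖P - c‖ ^ 2 + ‖R‖ ^ 2)

lemma dev_nonneg (P R c : ℂ) : 0 ≤ dev P R c := Real.sqrt_nonneg _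

lemma norm_sub_le_dev (P R c : ℂ) : ‖P - c‖ ≤ dev P R c :=
  Real.le_sqrt_of_sq_le (by nlinarith [norm_nonneg R])

lemma norm_le_dev (P R c : ℂ) : ‖R‖ ≤ dev P R c :=
  Real.le_sqrt_of_sq_le (by nlinarith [norm_nonneg (P - c)])

/-- The equation for `R` contains the large coefficient `2 σ`, but along paths with `Re σ ≤ 0` it
only makes `R` decay, so the growth is governed by `∫ ‖g‖` alone. The square root in `dev` is
smoothed by adding `δ ^ 2` under it. -/
lemma dev_gronwall {P R g σ : ℝ → ℂ} {B β : ℝ → ℝ} {a b : ℝ} (hab : a ≤ b) (c : ℂ)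
    (hP : ∀ t ∈ Set.Icc a b, HasDerivAt P (-(g t * (P t + R t) / 2)) t)
    (hR : ∀ t ∈ Set.Icc a b, HasDerivAt R (2 * σ t * R t + g t * (P t + R t) / 2) t)
    (hσ : ∀ t ∈ Set.Icc a b, (σ t).re ≤ 0) (hg : ∀ t ∈ Set.Icc a b, ‖g t‖ ≤ β t)
    (hB : ∀ t ∈ Set.Icc a b, HasDerivAt B (β t) t) :
    dev (P b) (R b) c + ‖c‖ ≤ (dev (P a) (R a) c + ‖c‖) * Real.exp (B b - B a) := by
  set k := ‖c‖ with hk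
  have hk0 : 0 ≤ k := norm_nonneg c
  have key : ∀ δ : ℝ, 0 < δ →
      √(‖P b - c‖ ^ 2 + ‖R b‖ ^ 2 + δ ^ 2) + k
        ≤ (√(‖P a - c‖ ^ 2 + ‖R a‖ ^ 2 + δ ^ 2) + k) * Real.exp (B b - B a) := by
    intro δ hδ
    set φ : ℝ → ℝ := fun t => √(‖P t - c‖ ^ 2 + ‖R t‖ ^ 2 + δ ^ 2) with hφ
    have hφsq : ∀ t, φ t ^ 2 = ‖P t - c‖ ^ 2 + ‖R t‖ ^ 2 + δ ^ 2 := fun t =>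
      Real.sq_sqrt (by positivity)
    have hφpos : ∀ t, 0 < φ t := fun t => Real.sqrt_pos.2 (by positivity)
    have hderiv : ∀ t ∈ Set.Icc a b, ∃ φ' : ℝ, HasDerivAt φ φ' t ∧ φ' ≤ β t * (φ t + k) := by
      intro t ht
      have h1 := ((hP t ht).sub_const c).norm_sq
      have h2 := (hR t ht).norm_sq
      have h3 := ((h1.add h2).add_const (δ ^ 2)).sqrt (by simp only [Pi.add_apply]; positivity)
      refine ⟨_, h3, ?_⟩
      have hβ : 0 ≤ β t := (norm_nonneg _).trans (hg t ht)
      set u := ‖P t - c‖ with hu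
      set v := ‖R t‖ with hv
      have hu0 : 0 ≤ u := norm_nonneg _
      have hv0 : 0 ≤ v := norm_nonneg _
      have hsum : ‖P t + R t‖ ≤ u + v + k := by
        calc ‖P t + R t‖ = ‖(P t - c) + R t + c‖ := by congr 1; ring
          _ ≤ u + v + k := norm_add₃_le
      have hF : ‖g t * (P t + R t) / 2‖ ≤ β t * (u + v + k) / 2 := by
        rw [norm_div, norm_mul, Complex.norm_ofNat]
        have := hg t ht
        gcongr
      have i1 : inner ℝ (P t - c) (-(g t * (P t + R t) / 2)) ≤ u * (β t * (u + v + k) / 2) := by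
        refine (real_inner_le_norm _ _).trans ?_
        rw [norm_neg]; gcongr
      have i2 : inner ℝ (R t) (2 * σ t * R t + g t * (P t + R t) / 2)
          ≤ v * (β t * (u + v + k) / 2) := by
        rw [inner_add_right]
        have e1 : inner ℝ (R t) (2 * σ t * R t) = 2 * (σ t).re * v ^ 2 := by
          rw [hv, ← Complex.normSq_eq_norm_sq, Complex.normSq_apply, Complex.inner]
          simp; ring
        have e2 : inner ℝ (R t) (g t * (P t + R t) / 2) ≤ v * (β t * (u + v + k) / 2) := by
          refine (real_inner_le_norm _ _).trans ?_
          gcongr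
        have := mul_nonneg (neg_nonneg.2 (hσ t ht)) (sq_nonneg v)
        rw [e1]; linarith
      have hφt := hφsq t
      have hφp := hφpos t
      change _ / (2 * φ t) ≤ _
      rw [div_le_iff₀ (by positivity)]
      have hφu : u ≤ φ t := by
        refine le_of_sq_le_sq ?_ hφp.le
        rw [hφt]; nlinarith
      have hφv : v ≤ φ t := by
        refine le_of_sq_le_sq ?_ hφp.le
        rw [hφt]; nlinarith
      have huv : (u + v) * (u + v + k) ≤ 2 * φ t * (φ t + k) := by
        nlinarith [sq_nonneg (u - v)]
      have := mul_le_mul_of_nonneg_left huv hβ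
      nlinarith
    have hmono : AntitoneOn (fun t => (φ t + k) * Real.exp (-B t)) (Set.Icc a b) := by
      have hd : ∀ t ∈ Set.Icc a b, ∃ d : ℝ,
          HasDerivAt (fun t => (φ t + k) * Real.exp (-B t)) d t ∧ d ≤ 0 := by
        intro t ht
        obtain ⟨φ', h, hle⟩ := hderiv t ht
        refine ⟨_, (h.add_const k).mul (hB t ht).neg.exp, ?_⟩
        have := Real.exp_pos (-B t)
        simp only [Pi.neg_apply]
        nlinarith
      refine antitoneOn_of_deriv_nonpos (convex_Icc a b)
        (fun t ht => (hd t ht).choose_spec.1.continuousAt.continuousWithinAt)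
        (fun t ht => (hd t (interior_subset ht)).choose_spec.1.differentiableAt.differentiableWithinAt)
        fun t ht => ?_
      obtain ⟨d, h, hle⟩ := hd t (interior_subset ht)
      rwa [h.deriv]
    have h := hmono (Set.left_mem_Icc.2 hab) (Set.right_mem_Icc.2 hab) hab
    have h' := mul_le_mul_of_nonneg_right h (Real.exp_pos (B b)).le
    simp only [mul_assoc, ← Real.exp_add] at h'
    rw [neg_add_cancel, Real.exp_zero, mul_one, show -B a + B b = B b - B a by ring] at h'
    exact h'
  refine le_of_forall_pos_le_add fun ε hε => ?_
  have hexp := Real.exp_pos (B b - B a)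
  have h := key (ε / Real.exp (B b - B a)) (by positivity)
  set δ := ε / Real.exp (B b - B a) with hδ
  have hδ0 : 0 < δ := by positivity
  have hleft : dev (P b) (R b) c ≤ √(‖P b - c‖ ^ 2 + ‖R b‖ ^ 2 + δ ^ 2) :=
    Real.sqrt_le_sqrt (by nlinarith)
  have hright : √(‖P a - c‖ ^ 2 + ‖R a‖ ^ 2 + δ ^ 2) ≤ dev (P a) (R a) c + δ := by
    rw [Real.sqrt_le_left (by have := dev_nonneg (P a) (R a) c; positivity)]
    have h1 := dev_nonneg (P a) (R a) c
    have h2 : dev (P a) (R a) c ^ 2 = ‖P a - c‖ ^ 2 + ‖R a‖ ^ 2 := Real.sq_sqrt (by positivity)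
    nlinarith
  calc dev (P b) (R b) c + k ≤ (√(‖P a - c‖ ^ 2 + ‖R a‖ ^ 2 + δ ^ 2) + k) * Real.exp (B b - B a) :=
        (by linarith : _ ≤ _).trans h
    _ ≤ (dev (P a) (R a) c + δ + k) * Real.exp (B b - B a) := by gcongr
    _ = (dev (P a) (R a) c + k) * Real.exp (B b - B a) + ε := by
        rw [hδ]; field_simp; ring

/-! ### Amplitudes in the logarithmic variable -/

/-- The exponent `2 / (m + 2) * z ^ ((m + 2) / 2)` as an entire function of `w = log z`. -/
def phase (m : ℕ) (w : ℂ) : ℂ := 2 / ((m : ℂ) + 2) * Complex.exp (((m : ℂ) + 2) / 2 * w)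

/-- The power `z ^ (m / 4)` as an entire function of `w = log z`. -/
def quarterPow (m : ℕ) (w : ℂ) : ℂ := Complex.exp ((m : ℂ) / 4 * w)

/-- With `z = exp w`, the normalization of `y` by its WKB approximation. -/
def ampA (m : ℕ) (y : ℂ → ℂ) (w : ℂ) : ℂ :=
  y (Complex.exp w) * quarterPow m w * Complex.exp (phase m w)

/-- With `z = exp w`, the derivative of `z ^ (m / 4) * y` with respect to the phase, normalized by
its WKB approximation. -/
def ampB (m : ℕ) (y y' : ℂ → ℂ) (w : ℂ) : ℂ :=
  -(y' (Complex.exp w) / quarterPow m w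
    + (m : ℂ) / 4 * y (Complex.exp w) / (quarterPow m w * Complex.exp w))
    * Complex.exp (phase m w)

/-- The amplitude of the decaying WKB solution in `y`. -/
def ampP (m : ℕ) (y y' : ℂ → ℂ) (w : ℂ) : ℂ := (ampA m y w + ampB m y y' w) / 2

/-- The amplitude of the growing WKB solution in `y`, multiplied by `exp (2 * phase)`, so that `y` is
`P + R` times the decaying WKB solution. -/
def ampR (m : ℕ) (y y' : ℂ → ℂ) (w : ℂ) : ℂ := (ampA m y w - ampB m y y' w) / 2

/-- The error term that drives the amplitudes, `lam * z ^ (1 - m / 2) - (m / 4) (m / 4 + 1) *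
z ^ (-1 - m / 2)` with `z = exp w`. -/
def errCoeff (m : ℕ) (lam w : ℂ) : ℂ :=
  lam * Complex.exp w / quarterPow m w ^ 2
    - (m : ℂ) / 4 * ((m : ℂ) / 4 + 1) / (quarterPow m w ^ 2 * Complex.exp w)

lemma quarterPow_ne_zero (m : ℕ) (w : ℂ) : quarterPow m w ≠ 0 := Complex.exp_ne_zero _

lemma quarterPow_sq_mul_exp (m : ℕ) (w : ℂ) :
    quarterPow m w ^ 2 * Complex.exp w = Complex.exp (((m : ℂ) + 2) / 2 * w) := by
  rw [quarterPow, ← Complex.exp_nat_mul, ← Complex.exp_add]; congr 1; push_cast; ring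

lemma quarterPow_pow_four (m : ℕ) (w : ℂ) : quarterPow m w ^ 4 = Complex.exp w ^ m := by
  rw [quarterPow, ← Complex.exp_nat_mul, ← Complex.exp_nat_mul]; congr 1; push_cast; ring

lemma hasDerivAt_quarterPow (m : ℕ) (w : ℂ) :
    HasDerivAt (quarterPow m) ((m : ℂ) / 4 * quarterPow m w) w := by
  have h := ((hasDerivAt_id w).const_mul ((m : ℂ) / 4)).cexp
  exact h.congr_deriv (by simp [quarterPow]; ring)

lemma hasDerivAt_phase (m : ℕ) (w : ℂ) :
    HasDerivAt (phase m) (quarterPow m w ^ 2 * Complex.exp w) w := by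
  have h := (((hasDerivAt_id w).const_mul (((m : ℂ) + 2) / 2)).cexp).const_mul (2 / ((m : ℂ) + 2))
  have h2 : (m : ℂ) + 2 ≠ 0 := by exact_mod_cast (m + 1).succ_ne_zero
  refine h.congr_deriv ?_
  rw [quarterPow_sq_mul_exp]; simp only [id]; field_simp

lemma hasDerivAt_ampA {m : ℕ} {lam : ℂ} {y y' : ℂ → ℂ} (h : IsSol m lam y y') (w : ℂ) :
    HasDerivAt (ampA m y)
      (quarterPow m w ^ 2 * Complex.exp w * (ampA m y w - ampB m y y' w)) w := by
  have hy : HasDerivAt (fun w => y (Complex.exp w)) _ w :=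
    (h (Complex.exp w)).1.comp w (Complex.hasDerivAt_exp w)
  have := (hy.mul (hasDerivAt_quarterPow m w)).mul (hasDerivAt_phase m w).cexp
  refine this.congr_deriv ?_
  have hE := quarterPow_ne_zero m w
  have he := Complex.exp_ne_zero w
  simp only [ampA, ampB, Pi.mul_apply]
  field_simp
  ring

lemma hasDerivAt_ampB {m : ℕ} {lam : ℂ} {y y' : ℂ → ℂ} (h : IsSol m lam y y') (w : ℂ) :
    HasDerivAt (ampB m y y')
      (quarterPow m w ^ 2 * Complex.exp w * (ampB m y y' w - ampA m y w)
        - errCoeff m lam w * ampA m y w) w := by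
  have hE := quarterPow_ne_zero m w
  have he := Complex.exp_ne_zero w
  have hy : HasDerivAt (fun w => y (Complex.exp w)) _ w :=
    (h (Complex.exp w)).1.comp w (Complex.hasDerivAt_exp w)
  have hy' : HasDerivAt (fun w => y' (Complex.exp w)) _ w :=
    (h (Complex.exp w)).2.comp w (Complex.hasDerivAt_exp w)
  have hq := hasDerivAt_quarterPow m w
  have := (((hy'.div hq hE).add ((hy.const_mul ((m : ℂ) / 4)).div
    (hq.mul (Complex.hasDerivAt_exp w)) (mul_ne_zero hE he))).neg).mul
    (hasDerivAt_phase m w).cexp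
  refine this.congr_deriv ?_
  simp only [ampA, ampB, errCoeff, Pi.mul_apply, Pi.add_apply, Pi.neg_apply, Pi.div_apply,
    ← quarterPow_pow_four]
  field_simp
  ring

lemma hasDerivAt_ampP {m : ℕ} {lam : ℂ} {y y' : ℂ → ℂ} (h : IsSol m lam y y') (w : ℂ) :
    HasDerivAt (ampP m y y')
      (-(errCoeff m lam w * (ampP m y y' w + ampR m y y' w) / 2)) w :=
  (((hasDerivAt_ampA h w).add (hasDerivAt_ampB h w)).div_const 2).congr_deriv
    (by simp only [ampP, ampR]; ring)

lemma hasDerivAt_ampR {m : ℕ} {lam : ℂ} {y y' : ℂ → ℂ} (h : IsSol m lam y y') (w : ℂ) :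
    HasDerivAt (ampR m y y')
      (2 * Complex.exp (((m : ℂ) + 2) / 2 * w) * ampR m y y' w
        + errCoeff m lam w * (ampP m y y' w + ampR m y y' w) / 2) w :=
  (((hasDerivAt_ampA h w).sub (hasDerivAt_ampB h w)).div_const 2).congr_deriv
    (by simp only [ampP, ampR, ← quarterPow_sq_mul_exp]; ring)

lemma apply_exp_eq (m : ℕ) (y y' : ℂ → ℂ) (w : ℂ) :
    y (Complex.exp w) = (ampP m y y' w + ampR m y y' w)
      * ((quarterPow m w)⁻¹ * Complex.exp (-phase m w)) := by
  have hE := quarterPow_ne_zero m w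
  have hS := Complex.exp_ne_zero (phase m w)
  simp only [ampP, ampR, ampA, Complex.exp_neg]
  field_simp
  ring

lemma deriv_apply_exp_eq (m : ℕ) (y y' : ℂ → ℂ) (w : ℂ) :
    y' (Complex.exp w) = (ampP m y y' w - ampR m y y' w
        + (m : ℂ) / 4 * (ampP m y y' w + ampR m y y' w) / (quarterPow m w ^ 2 * Complex.exp w))
      * (-quarterPow m w * Complex.exp (-phase m w)) := by
  have hE := quarterPow_ne_zero m w
  have he := Complex.exp_ne_zero w
  have hS := Complex.exp_ne_zero (phase m w)
  simp only [ampP, ampR, ampA, ampB, Complex.exp_neg]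
  field_simp
  ring

lemma ampP_lin (m : ℕ) (y₁ y₁' y₂ y₂' : ℂ → ℂ) (α β w : ℂ) :
    ampP m (fun z => α * y₁ z + β * y₂ z) (fun z => α * y₁' z + β * y₂' z) w
      = α * ampP m y₁ y₁' w + β * ampP m y₂ y₂' w := by
  simp only [ampP, ampA, ampB]; ring

lemma ampR_lin (m : ℕ) (y₁ y₁' y₂ y₂' : ℂ → ℂ) (α β w : ℂ) :
    ampR m (fun z => α * y₁ z + β * y₂ z) (fun z => α * y₁' z + β * y₂' z) w
      = α * ampR m y₁ y₁' w + β * ampR m y₂ y₂' w := by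
  simp only [ampR, ampA, ampB]; ring

/-- A constant for `errCoeff` when `‖lam‖ ≤ L`. -/
def errBound (m : ℕ) (L : ℝ) : ℝ := L + (m : ℝ) / 4 * ((m : ℝ) / 4 + 1)

lemma errBound_nonneg (m : ℕ) {L : ℝ} (hL : 0 ≤ L) : 0 ≤ errBound m L := by
  unfold errBound; positivity

lemma norm_quarterPow (m : ℕ) (w : ℂ) : ‖quarterPow m w‖ = Real.exp ((m : ℝ) / 4 * w.re) := by
  rw [quarterPow, Complex.norm_exp]
  congr 1
  rw [show (m : ℂ) / 4 = ((m / 4 : ℝ) : ℂ) by push_cast; ring, Complex.re_ofReal_mul]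

/-- This is where `m ≥ 3` enters: `1 - m / 2 ≤ -1 / 2`, so that the error term is integrable at
infinity in the variable `w = log z`. -/
lemma norm_errCoeff_le {m : ℕ} (hm : 3 ≤ m) {L : ℝ} {lam w : ℂ} (hlam : ‖lam‖ ≤ L)
    (hw : 0 ≤ w.re) : ‖errCoeff m lam w‖ ≤ errBound m L * Real.exp (-w.re / 2) := by
  have hm' : (3 : ℝ) ≤ m := by exact_mod_cast hm
  have hq : ‖quarterPow m w‖ ^ 2 = Real.exp ((m : ℝ) / 2 * w.re) := by
    rw [norm_quarterPow, ← Real.exp_nat_mul]; congr 1; push_cast; ring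
  have h1 : ‖lam * Complex.exp w / quarterPow m w ^ 2‖ ≤ L * Real.exp (-w.re / 2) := by
    rw [norm_div, norm_mul, norm_pow, hq, Complex.norm_exp, mul_div_assoc, ← Real.exp_sub]
    have : w.re - m / 2 * w.re ≤ -w.re / 2 := by nlinarith
    have hL : 0 ≤ L := (norm_nonneg _).trans hlam
    gcongr
  have h2 : ‖(m : ℂ) / 4 * ((m : ℂ) / 4 + 1) / (quarterPow m w ^ 2 * Complex.exp w)‖
      ≤ (m : ℝ) / 4 * ((m : ℝ) / 4 + 1) * Real.exp (-w.re / 2) := by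
    have hc : ‖(m : ℂ) / 4 * ((m : ℂ) / 4 + 1)‖ = (m : ℝ) / 4 * ((m : ℝ) / 4 + 1) := by
      rw [show (m : ℂ) / 4 * ((m : ℂ) / 4 + 1) = (((m : ℝ) / 4 * ((m : ℝ) / 4 + 1) : ℝ) : ℂ) by
        push_cast; ring, Complex.norm_real, Real.norm_eq_abs, abs_of_nonneg (by positivity)]
    rw [norm_div, hc, norm_mul, norm_pow, hq, Complex.norm_exp, ← Real.exp_add, div_eq_mul_inv,
      ← Real.exp_neg]
    have : -(m / 2 * w.re + w.re) ≤ -w.re / 2 := by nlinarith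
    gcongr
  calc ‖errCoeff m lam w‖ ≤ _ := norm_sub_le _ _
    _ ≤ _ := add_le_add h1 h2
    _ = errBound m L * Real.exp (-w.re / 2) := by rw [errBound]; ring

/-- Transport of the amplitudes along the segment from `w` to `w + d`, on which the real part of
the phase has to decrease. -/
lemma dev_segment_le {m : ℕ} {lam : ℂ} {y y' : ℂ → ℂ} (h : IsSol m lam y y') (w d c : ℂ)
    {B β : ℝ → ℝ}
    (hd : ∀ t ∈ Set.Icc (0 : ℝ) 1, (d * Complex.exp (((m : ℂ) + 2) / 2 * (w + t * d))).re ≤ 0)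
    (hβ : ∀ t ∈ Set.Icc (0 : ℝ) 1, ‖d‖ * ‖errCoeff m lam (w + t * d)‖ ≤ β t)
    (hB : ∀ t ∈ Set.Icc (0 : ℝ) 1, HasDerivAt B (β t) t) :
    dev (ampP m y y' (w + d)) (ampR m y y' (w + d)) c + ‖c‖
      ≤ (dev (ampP m y y' w) (ampR m y y' w) c + ‖c‖) * Real.exp (B 1 - B 0) := by
  have hpath : ∀ t : ℝ, HasDerivAt (fun s : ℂ => w + s * d) d (t : ℂ) := fun t => by
    simpa using ((hasDerivAt_id (t : ℂ)).mul_const d).const_add w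
  have hcomp : ∀ (F : ℂ → ℂ) (F' : ℂ) (t : ℝ), HasDerivAt F F' (w + t * d) →
      HasDerivAt (fun t : ℝ => F (w + t * d)) (F' * d) t := fun F F' t hF =>
    (hF.comp (t : ℂ) (hpath t)).comp_ofReal
  have := dev_gronwall (P := fun t : ℝ => ampP m y y' (w + t * d))
    (R := fun t : ℝ => ampR m y y' (w + t * d)) (g := fun t => d * errCoeff m lam (w + t * d))
    (σ := fun t => d * Complex.exp (((m : ℂ) + 2) / 2 * (w + t * d)))
    zero_le_one c
    (fun t _ => (hcomp _ _ t (hasDerivAt_ampP h (w + t * d))).congr_deriv (by ring))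
    (fun t _ => (hcomp _ _ t (hasDerivAt_ampR h (w + t * d))).congr_deriv (by ring))
    hd (fun t ht => by rw [norm_mul]; exact hβ t ht) hB
  simpa using this

/-- Transport along the real axis, from `X` down to `x`. -/
lemma dev_real_le {m : ℕ} (hm : 3 ≤ m) {L : ℝ} {lam : ℂ} (hlam : ‖lam‖ ≤ L) {y y' : ℂ → ℂ}
    (h : IsSol m lam y y') (c : ℂ) {x X : ℝ} (hx : 0 ≤ x) (hX : x ≤ X) :
    dev (ampP m y y' x) (ampR m y y' x) c + ‖c‖
      ≤ (dev (ampP m y y' X) (ampR m y y' X) c + ‖c‖)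
        * Real.exp (2 * errBound m L * Real.exp (-x / 2)) := by
  have hL := errBound_nonneg m ((norm_nonneg _).trans hlam)
  have hre : ∀ t : ℝ, (X : ℂ) + t * ((x : ℂ) - X) = ((X + t * (x - X) : ℝ) : ℂ) := fun t => by
    push_cast; ring
  have hpos : ∀ t ∈ Set.Icc (0 : ℝ) 1, 0 ≤ X + t * (x - X) := fun t ht => by
    nlinarith [ht.1, ht.2]
  have hnorm : ‖(x : ℂ) - X‖ = X - x := by
    rw [← Complex.ofReal_sub, Complex.norm_real, Real.norm_eq_abs, abs_sub_comm,
      abs_of_nonneg (by linarith)]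
  have := dev_segment_le h (X : ℂ) ((x : ℂ) - X) c
    (B := fun t => 2 * errBound m L * Real.exp (-(X + t * (x - X)) / 2))
    (β := fun t => (X - x) * (errBound m L * Real.exp (-(X + t * (x - X)) / 2)))
    (fun t _ => ?_) (fun t ht => ?_) (fun t _ => ?_)
  · rw [add_sub_cancel] at this
    refine this.trans ?_
    have h0 := dev_nonneg (ampP m y y' X) (ampR m y y' X) c
    gcongr
    have : 0 ≤ 2 * errBound m L * Real.exp (-(X + 0 * (x - X)) / 2) := by positivity
    have e : X + 1 * (x - X) = x := by ring
    rw [e]; linarith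
  · rw [hre, show ((m : ℂ) + 2) / 2 * ((X + t * (x - X) : ℝ) : ℂ)
      = (((m + 2) / 2 * (X + t * (x - X)) : ℝ) : ℂ) by push_cast; ring, ← Complex.ofReal_exp,
      ← Complex.ofReal_sub, ← Complex.ofReal_mul, Complex.ofReal_re]
    exact mul_nonpos_of_nonpos_of_nonneg (by linarith) (Real.exp_pos _).le
  · rw [hnorm, hre]
    refine mul_le_mul_of_nonneg_left ?_ (by linarith)
    exact norm_errCoeff_le hm hlam (by simpa using hpos t ht)
  · have h1 : HasDerivAt (fun t : ℝ => -(X + t * (x - X)) / 2) (-(x - X) / 2) t := by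
      simpa using ((((hasDerivAt_id t).mul_const (x - X)).const_add X).neg).div_const 2
    exact (h1.exp.const_mul (2 * errBound m L)).congr_deriv (by ring)

/-! ### The subdominant solution as a limit -/

/-- The limit of entire functions that form a Cauchy sequence locally uniformly is entire. -/
lemma exists_differentiable_limit {α : ℕ → ℂ → ℂ} (hα : ∀ N, Differentiable ℂ (α N))
    (hc : ∀ L : ℝ, ∃ η : ℕ → ℝ, Tendsto η atTop (𝓝 0) ∧
      ∀ N M lam, N ≤ M → ‖lam‖ ≤ L → ‖α M lam - α N lam‖ ≤ η N) :
    ∃ α' : ℂ → ℂ, Differentiable ℂ α' ∧ ∀ lam, Tendsto (fun N => α N lam) atTop (𝓝 (α' lam)) := by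
  have hcauchy : ∀ L : ℝ, UniformCauchySeqOn α atTop {lam | ‖lam‖ ≤ L} := by
    intro L
    obtain ⟨η, hη, h⟩ := hc L
    rw [Metric.uniformCauchySeqOn_iff]
    intro ε hε
    obtain ⟨N, hN⟩ := (hη.eventually (gt_mem_nhds hε)).exists_forall_of_atTop
    refine ⟨N, fun i hi j hj lam hlam => ?_⟩
    rcases le_total i j with hij | hij
    · rw [dist_comm, dist_eq_norm]
      exact (h i j lam hij hlam).trans_lt (hN i hi)
    · rw [dist_eq_norm]
      exact (h j i lam hij hlam).trans_lt (hN j hj)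
  have hlim : ∀ lam, ∃ l, Tendsto (fun N => α N lam) atTop (𝓝 l) := fun lam =>
    cauchySeq_tendsto_of_complete ((hcauchy ‖lam‖).cauchySeq (by simp))
  choose α' hα' using hlim
  refine ⟨α', fun lam => ?_, hα'⟩
  have hunif : TendstoUniformlyOn α α' atTop (Metric.ball 0 (‖lam‖ + 1)) :=
    ((hcauchy (‖lam‖ + 1)).tendstoUniformlyOn_of_tendsto fun x _ => hα' x).mono fun x hx => by
      have : ‖x‖ < ‖lam‖ + 1 := by simpa using hx
      exact this.le
  exact (hunif.tendstoLocallyUniformlyOn.differentiableOn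
    (Eventually.of_forall fun N => (hα N).differentiableOn) Metric.isOpen_ball).differentiableAt
    (Metric.isOpen_ball.mem_nhds (by simp))

/-- The value at `exp N` of the solution with `P = 1` and `R = 0` there. -/
def seedVal (m N : ℕ) : ℂ := (quarterPow m N)⁻¹ * Complex.exp (-phase m N)

/-- The derivative at `exp N` of the solution with `P = 1` and `R = 0` there. -/
def seedDeriv (m N : ℕ) : ℂ :=
  -(quarterPow m N * Complex.exp (-phase m N)) - (m : ℂ) / 4 * seedVal m N / Complex.exp N

lemma amp_of_seed {m N : ℕ} {y y' : ℂ → ℂ} (h : y (Complex.exp N) = seedVal m N)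
    (h' : y' (Complex.exp N) = seedDeriv m N) :
    ampP m y y' N = 1 ∧ ampR m y y' N = 0 := by
  have hE := quarterPow_ne_zero m N
  have he := Complex.exp_ne_zero N
  have hS := Complex.exp_ne_zero (phase m N)
  simp only [ampP, ampR, ampA, ampB, h, h', seedDeriv, seedVal, Complex.exp_neg]
  constructor <;> field_simp <;> ring

/-- The first coordinate, in a fundamental system, of the solution with value `u` and derivative
`v` at `z`. -/
def coordA (y₂ y₂' : ℂ → ℂ → ℂ) (z u v lam : ℂ) : ℂ := u * y₂' z lam - v * y₂ z lam

/-- The second coordinate, in a fundamental system, of the solution with value `u` and derivative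
`v` at `z`. -/
def coordB (y₁ y₁' : ℂ → ℂ → ℂ) (z u v lam : ℂ) : ℂ := v * y₁ z lam - u * y₁' z lam

lemma differentiable_snd_apply {y : ℂ → ℂ → ℂ}
    (h : Differentiable ℂ fun p : ℂ × ℂ => y p.1 p.2) (z : ℂ) : Differentiable ℂ (y z) :=
  h.comp ((differentiable_const z).prodMk differentiable_id)

/-- The coordinates of a solution are bounded by its amplitudes at `w = 0`, uniformly for bounded
`lam`. -/
lemma IsFundamental.exists_coord_bound {m : ℕ} {y₁ y₁' y₂ y₂' : ℂ → ℂ → ℂ}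
    (hy : IsFundamental m y₁ y₁' y₂ y₂') (L : ℝ) :
    ∃ K : ℝ, 0 ≤ K ∧ ∀ lam α β : ℂ, ‖lam‖ ≤ L →
      ‖α‖ ≤ K * dev (ampP m (fun z => α * y₁ z lam + β * y₂ z lam)
          (fun z => α * y₁' z lam + β * y₂' z lam) 0)
        (ampR m (fun z => α * y₁ z lam + β * y₂ z lam)
          (fun z => α * y₁' z lam + β * y₂' z lam) 0) 0 ∧
      ‖β‖ ≤ K * dev (ampP m (fun z => α * y₁ z lam + β * y₂ z lam)
          (fun z => α * y₁' z lam + β * y₂' z lam) 0)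
        (ampR m (fun z => α * y₁ z lam + β * y₂ z lam)
          (fun z => α * y₁' z lam + β * y₂' z lam) 0) 0 := by
  have hbd : ∀ y : ℂ → ℂ → ℂ, (Differentiable ℂ fun p : ℂ × ℂ => y p.1 p.2) →
      ∃ c : ℝ, 0 ≤ c ∧ ∀ lam, ‖lam‖ ≤ L → ‖y 1 lam‖ ≤ c := fun y h => by
    obtain ⟨c, hc⟩ := (isCompact_closedBall (0 : ℂ) L).exists_bound_of_continuousOn
      (differentiable_snd_apply h 1).continuous.continuousOn
    exact ⟨|c|, abs_nonneg c, fun lam hlam => (hc lam (by simpa using hlam)).trans (le_abs_self c)⟩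
  obtain ⟨c₁, hc₁, h₁⟩ := hbd _ hy.diff₁
  obtain ⟨c₁', hc₁', h₁'⟩ := hbd _ hy.diff₁'
  obtain ⟨c₂, hc₂, h₂⟩ := hbd _ hy.diff₂
  obtain ⟨c₂', hc₂', h₂'⟩ := hbd _ hy.diff₂'
  set s : ℝ := ‖Complex.exp (-phase m 0)‖ with hs
  set q : ℝ := 2 + (m : ℝ) / 4 * 2 with hq
  have hq0 : 0 ≤ q := by positivity
  refine ⟨2 * s * (c₂' + c₁') + q * s * (c₂ + c₁), by positivity, fun lam α β hlam => ?_⟩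
  set Y : ℂ → ℂ := fun z => α * y₁ z lam + β * y₂ z lam with hY
  set Y' : ℂ → ℂ := fun z => α * y₁' z lam + β * y₂' z lam with hY'
  set D := dev (ampP m Y Y' 0) (ampR m Y Y' 0) 0 with hD
  have hP : ‖ampP m Y Y' 0‖ ≤ D := by simpa using norm_sub_le_dev (ampP m Y Y' 0) (ampR m Y Y' 0) 0
  have hR : ‖ampR m Y Y' 0‖ ≤ D := norm_le_dev _ _ 0
  have hD0 : 0 ≤ D := dev_nonneg _ _ _
  have hE : quarterPow m 0 = 1 := by simp [quarterPow]
  have hm4 : ‖(m : ℂ) / 4‖ = (m : ℝ) / 4 := by simp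
  have hv : ‖Y 1‖ ≤ 2 * s * D := by
    have := apply_exp_eq m Y Y' 0
    rw [Complex.exp_zero, hE, inv_one, one_mul] at this
    rw [this, norm_mul]
    calc _ ≤ (D + D) * s := by
          gcongr
          exact (norm_add_le _ _).trans (add_le_add hP hR)
      _ = 2 * s * D := by ring
  have hd : ‖Y' 1‖ ≤ q * s * D := by
    have := deriv_apply_exp_eq m Y Y' 0
    rw [Complex.exp_zero, hE, one_pow, mul_one, div_one, neg_mul, one_mul, mul_neg] at this
    rw [this, norm_neg, norm_mul]
    calc _ ≤ ((D + D) + (m : ℝ) / 4 * (D + D)) * s := by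
          gcongr
          refine (norm_add_le _ _).trans (add_le_add ?_ ?_)
          · exact (norm_sub_le _ _).trans (add_le_add hP hR)
          · rw [norm_mul, hm4]
            gcongr
            exact (norm_add_le _ _).trans (add_le_add hP hR)
      _ = q * s * D := by rw [hq]; ring
  have hW := hy.wronskian 1 lam
  have hα : α = Y 1 * y₂' 1 lam - Y' 1 * y₂ 1 lam := by
    simp only [hY, hY']; linear_combination (-α) * hW
  have hβ : β = Y' 1 * y₁ 1 lam - Y 1 * y₁' 1 lam := by
    simp only [hY, hY']; linear_combination (-β) * hW
  have e : ∀ a b c d : ℂ, ‖a * b - c * d‖ ≤ ‖a‖ * ‖b‖ + ‖c‖ * ‖d‖ := fun a b c d => by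
    rw [← norm_mul, ← norm_mul]; exact norm_sub_le _ _
  have hs0 : 0 ≤ s := norm_nonneg _
  constructor
  · calc ‖α‖ = ‖Y 1 * y₂' 1 lam - Y' 1 * y₂ 1 lam‖ := congrArg norm hα
      _ ≤ 2 * s * D * c₂' + q * s * D * c₂ := (e _ _ _ _).trans (by
          gcongr
          · exact h₂' lam hlam
          · exact h₂ lam hlam)
      _ ≤ _ := by
          have : 0 ≤ 2 * s * c₁' * D + q * s * c₁ * D := by positivity
          linarith
  · calc ‖β‖ = ‖Y' 1 * y₁ 1 lam - Y 1 * y₁' 1 lam‖ := congrArg norm hβ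
      _ ≤ q * s * D * c₁ + 2 * s * D * c₁' := (e _ _ _ _).trans (by
          gcongr
          · exact h₁ lam hlam
          · exact h₁' lam hlam)
      _ ≤ _ := by
          have : 0 ≤ 2 * s * c₂' * D + q * s * c₂ * D := by positivity
          linarith

/-- A solution, entire in `(z, lam)`, whose amplitudes tend to `(1, 0)` along the positive real
axis. It is the limit of the solutions that have amplitudes exactly `(1, 0)` at `z = exp N`: by
the Grönwall estimate the difference of two of these is small at `z = 1`. -/
lemma exists_sol_real {m : ℕ} (hm : 3 ≤ m) : ∃ f f' : ℂ → ℂ → ℂ,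
    (Differentiable ℂ fun p : ℂ × ℂ => f p.1 p.2) ∧
    (∀ lam, IsSol m lam (fun z => f z lam) (fun z => f' z lam)) ∧
    ∀ (L : ℝ) (lam : ℂ), ‖lam‖ ≤ L → ∀ x : ℝ, 0 ≤ x →
      dev (ampP m (fun z => f z lam) (fun z => f' z lam) x)
          (ampR m (fun z => f z lam) (fun z => f' z lam) x) 1 + 1
        ≤ Real.exp (2 * errBound m L * Real.exp (-x / 2)) := by
  obtain ⟨y₁, y₁', y₂, y₂', hy⟩ := exists_isFundamental m
  set α : ℕ → ℂ → ℂ := fun N =>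
    coordA y₂ y₂' (Complex.exp N) (seedVal m N) (seedDeriv m N) with hα
  set β : ℕ → ℂ → ℂ := fun N =>
    coordB y₁ y₁' (Complex.exp N) (seedVal m N) (seedDeriv m N) with hβ
  have hαd : ∀ N, Differentiable ℂ (α N) := fun N =>
    ((differentiable_snd_apply hy.diff₂' _).const_mul _).sub
      ((differentiable_snd_apply hy.diff₂ _).const_mul _)
  have hβd : ∀ N, Differentiable ℂ (β N) := fun N =>
    ((differentiable_snd_apply hy.diff₁ _).const_mul _).sub
      ((differentiable_snd_apply hy.diff₁' _).const_mul _)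
  set Y : ℕ → ℂ → ℂ → ℂ := fun N lam z => α N lam * y₁ z lam + β N lam * y₂ z lam with hY
  set Y' : ℕ → ℂ → ℂ → ℂ := fun N lam z => α N lam * y₁' z lam + β N lam * y₂' z lam with hY'
  have hsol : ∀ N lam, IsSol m lam (Y N lam) (Y' N lam) := fun N lam =>
    (hy.sol₁ lam).lin (hy.sol₂ lam) _ _
  have hseed : ∀ N lam, ampP m (Y N lam) (Y' N lam) (N : ℝ) = 1 ∧
      ampR m (Y N lam) (Y' N lam) (N : ℝ) = 0 := fun N lam => by
    have hW := hy.wronskian (Complex.exp N) lam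
    rw [Complex.ofReal_natCast]
    refine amp_of_seed ?_ ?_
    · simp only [hY, hα, hβ, coordA, coordB]; linear_combination seedVal m N * hW
    · simp only [hY', hα, hβ, coordA, coordB]; linear_combination seedDeriv m N * hW
  have hreal : ∀ (L : ℝ) (N : ℕ) lam, ‖lam‖ ≤ L → ∀ x : ℝ, 0 ≤ x → x ≤ N →
      dev (ampP m (Y N lam) (Y' N lam) x) (ampR m (Y N lam) (Y' N lam) x) 1 + 1
        ≤ Real.exp (2 * errBound m L * Real.exp (-x / 2)) := by
    intro L N lam hlam x hx hxN
    have := dev_real_le hm hlam (hsol N lam) 1 hx hxN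
    rw [(hseed N lam).1, (hseed N lam).2] at this
    simpa [dev] using this
  have hdiff : ∀ (L : ℝ) N M lam, N ≤ M → ‖lam‖ ≤ L →
      dev (ampP m (fun z => (α M lam - α N lam) * y₁ z lam + (β M lam - β N lam) * y₂ z lam)
          (fun z => (α M lam - α N lam) * y₁' z lam + (β M lam - β N lam) * y₂' z lam) 0)
        (ampR m (fun z => (α M lam - α N lam) * y₁ z lam + (β M lam - β N lam) * y₂ z lam)
          (fun z => (α M lam - α N lam) * y₁' z lam + (β M lam - β N lam) * y₂' z lam) 0) 0
      ≤ (Real.exp (2 * errBound m L * Real.exp (-(N : ℝ) / 2)) - 1)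
        * Real.exp (2 * errBound m L) := by
    intro L N M lam hNM hlam
    have h := dev_real_le hm hlam ((hy.sol₁ lam).lin (hy.sol₂ lam) (α M lam - α N lam)
      (β M lam - β N lam)) 0 le_rfl (Nat.cast_nonneg N)
    simp only [norm_zero, add_zero, Complex.ofReal_zero, neg_zero, zero_div, Real.exp_zero,
      mul_one] at h
    refine h.trans ?_
    gcongr
    have hM := hreal L M lam hlam N (Nat.cast_nonneg N) (by exact_mod_cast hNM)
    have hN := hseed N lam
    have hdevM : dev (ampP m (fun z => (α M lam - α N lam) * y₁ z lam
            + (β M lam - β N lam) * y₂ z lam)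
          (fun z => (α M lam - α N lam) * y₁' z lam + (β M lam - β N lam) * y₂' z lam) (N : ℝ))
        (ampR m (fun z => (α M lam - α N lam) * y₁ z lam + (β M lam - β N lam) * y₂ z lam)
          (fun z => (α M lam - α N lam) * y₁' z lam + (β M lam - β N lam) * y₂' z lam) (N : ℝ)) 0
        = dev (ampP m (Y M lam) (Y' M lam) (N : ℝ)) (ampR m (Y M lam) (Y' M lam) (N : ℝ)) 1 := by
      have e1 : ampP m (fun z => (α M lam - α N lam) * y₁ z lam + (β M lam - β N lam) * y₂ z lam)
          (fun z => (α M lam - α N lam) * y₁' z lam + (β M lam - β N lam) * y₂' z lam) (N : ℝ)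
          = ampP m (Y M lam) (Y' M lam) (N : ℝ) - 1 := by
        rw [← hN.1]; simp only [hY, hY', ampP_lin]; ring
      have e2 : ampR m (fun z => (α M lam - α N lam) * y₁ z lam + (β M lam - β N lam) * y₂ z lam)
          (fun z => (α M lam - α N lam) * y₁' z lam + (β M lam - β N lam) * y₂' z lam) (N : ℝ)
          = ampR m (Y M lam) (Y' M lam) (N : ℝ) := by
        rw [← sub_zero (ampR m (Y M lam) (Y' M lam) (N : ℝ)), ← hN.2]
        simp only [hY, hY', ampR_lin]; ring
      rw [e1, e2]; simp [dev]
    rw [hdevM]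
    linarith
  have hη : ∀ L K : ℝ, Tendsto (fun N : ℕ => K *
      ((Real.exp (2 * errBound m L * Real.exp (-(N : ℝ) / 2)) - 1)
        * Real.exp (2 * errBound m L))) atTop (𝓝 0) := by
    intro L K
    have h1 : Tendsto (fun N : ℕ => Real.exp (-(N : ℝ) / 2)) atTop (𝓝 0) := by
      refine Real.tendsto_exp_atBot.comp ?_
      exact (tendsto_neg_atTop_atBot.comp tendsto_natCast_atTop_atTop).atBot_div_const two_pos
    have h2 := (Real.continuous_exp.tendsto _).comp (h1.const_mul (2 * errBound m L))
    have h3 := ((h2.sub_const 1).mul_const (Real.exp (2 * errBound m L))).const_mul K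
    simpa using h3
  obtain ⟨α', hα'd, hα'⟩ := exists_differentiable_limit hαd fun L => by
    obtain ⟨K, hK, h⟩ := hy.exists_coord_bound L
    refine ⟨_, hη L K, fun N M lam hNM hlam => (h lam _ (β M lam - β N lam) hlam).1.trans ?_⟩
    exact mul_le_mul_of_nonneg_left (hdiff L N M lam hNM hlam) hK
  obtain ⟨β', hβ'd, hβ'⟩ := exists_differentiable_limit hβd fun L => by
    obtain ⟨K, hK, h⟩ := hy.exists_coord_bound L
    refine ⟨_, hη L K, fun N M lam hNM hlam => (h lam (α M lam - α N lam) _ hlam).2.trans ?_⟩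
    exact mul_le_mul_of_nonneg_left (hdiff L N M lam hNM hlam) hK
  refine ⟨fun z lam => α' lam * y₁ z lam + β' lam * y₂ z lam,
    fun z lam => α' lam * y₁' z lam + β' lam * y₂' z lam,
    ((hα'd.comp differentiable_snd).mul hy.diff₁).add
      ((hβ'd.comp differentiable_snd).mul hy.diff₂),
    fun lam => (hy.sol₁ lam).lin (hy.sol₂ lam) _ _, fun L lam hlam x hx => ?_⟩
  have hP : Tendsto (fun N => ampP m (Y N lam) (Y' N lam) x) atTop
      (𝓝 (ampP m (fun z => α' lam * y₁ z lam + β' lam * y₂ z lam)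
        (fun z => α' lam * y₁' z lam + β' lam * y₂' z lam) x)) := by
    simp only [hY, hY', ampP_lin]
    exact ((hα' lam).mul_const _).add ((hβ' lam).mul_const _)
  have hR : Tendsto (fun N => ampR m (Y N lam) (Y' N lam) x) atTop
      (𝓝 (ampR m (fun z => α' lam * y₁ z lam + β' lam * y₂ z lam)
        (fun z => α' lam * y₁' z lam + β' lam * y₂' z lam) x)) := by
    simp only [hY, hY', ampR_lin]
    exact ((hα' lam).mul_const _).add ((hβ' lam).mul_const _)
  have hdev : Tendsto (fun N => dev (ampP m (Y N lam) (Y' N lam) x) (ampR m (Y N lam) (Y' N lam) x)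
      1 + 1) atTop (𝓝 (dev _ _ 1 + 1)) :=
    ((Real.continuous_sqrt.tendsto _).comp
      (((hP.sub_const 1).norm.pow 2).add (hR.norm.pow 2))).add_const 1
  refine le_of_tendsto hdev ?_
  filter_upwards [eventually_ge_atTop ⌈x⌉₊] with N hN
  exact hreal L N lam hlam x hx ((Nat.le_ceil x).trans (by exact_mod_cast hN))

/-! ### Asymptotics in the sector -/

/-- Transport along a segment in the half-plane `x ≤ Re w`. -/
lemma dev_segment_le_of_re {m : ℕ} (hm : 3 ≤ m) {L : ℝ} {lam : ℂ} (hlam : ‖lam‖ ≤ L)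
    {y y' : ℂ → ℂ} (h : IsSol m lam y y') (w d : ℂ) {x : ℝ} (hx : 0 ≤ x) (hw : x ≤ w.re)
    (hwd : x ≤ (w + d).re)
    (hd : ∀ t ∈ Set.Icc (0 : ℝ) 1, (d * Complex.exp (((m : ℂ) + 2) / 2 * (w + t * d))).re ≤ 0) :
    dev (ampP m y y' (w + d)) (ampR m y y' (w + d)) 1 + 1
      ≤ (dev (ampP m y y' w) (ampR m y y' w) 1 + 1)
        * Real.exp (‖d‖ * (errBound m L * Real.exp (-x / 2))) := by
  have hL := errBound_nonneg m ((norm_nonneg _).trans hlam)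
  have := dev_segment_le h w d 1
    (B := fun t => t * (‖d‖ * (errBound m L * Real.exp (-x / 2))))
    (β := fun _ => ‖d‖ * (errBound m L * Real.exp (-x / 2))) hd (fun t ht => ?_)
    (fun t _ => by simpa using (hasDerivAt_id t).mul_const _)
  · simpa using this
  · have hre : x ≤ (w + t * d).re := by
      have e : (w + t * d).re = w.re + t * d.re := by simp
      have e' : (w + d).re = w.re + d.re := by simp
      rw [e'] at hwd
      rw [e]
      nlinarith [mul_nonneg ht.1 (sub_nonneg.2 hwd), mul_nonneg (sub_nonneg.2 ht.2)
        (sub_nonneg.2 hw)]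
    refine mul_le_mul_of_nonneg_left ((norm_errCoeff_le hm hlam (hx.trans hre)).trans ?_)
      (norm_nonneg d)
    gcongr

/-- The real part of `d * exp (n * w)` for real `n`, in terms of real and imaginary parts. -/
lemma re_mul_exp (m : ℕ) (p q X Θ : ℝ) :
    (((p : ℂ) + q * Complex.I) * Complex.exp (((m : ℂ) + 2) / 2 * (X + Θ * Complex.I))).re
      = Real.exp (((m : ℝ) + 2) / 2 * X)
        * (p * Real.cos (((m : ℝ) + 2) / 2 * Θ) - q * Real.sin (((m : ℝ) + 2) / 2 * Θ)) := by
  have e : ((m : ℂ) + 2) / 2 * (X + Θ * Complex.I)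
      = ((((m : ℝ) + 2) / 2 * X : ℝ) : ℂ) + ((((m : ℝ) + 2) / 2 * Θ : ℝ) : ℂ) * Complex.I := by
    push_cast; ring
  rw [e, Complex.mul_re, Complex.exp_re, Complex.exp_im]
  simp only [Complex.add_re, Complex.add_im, Complex.ofReal_re, Complex.ofReal_im, Complex.mul_re,
    Complex.mul_im, Complex.I_re, Complex.I_im]
  ring_nf

/-- On the arc `|z| = exp x`, `|arg z| ≤ 2 π / (m + 2)`, the real part of the phase decreases away
from the real axis. -/
lemma dev_arc_le {m : ℕ} (hm : 3 ≤ m) {L : ℝ} {lam : ℂ} (hlam : ‖lam‖ ≤ L) {y y' : ℂ → ℂ}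
    (h : IsSol m lam y y')
    (hreal : ∀ x : ℝ, 0 ≤ x → dev (ampP m y y' x) (ampR m y y' x) 1 + 1
      ≤ Real.exp (2 * errBound m L * Real.exp (-x / 2)))
    {x θ : ℝ} (hx : 0 ≤ x) (hθ : ((m : ℝ) + 2) / 2 * |θ| ≤ Real.pi) :
    dev (ampP m y y' (x + θ * Complex.I)) (ampR m y y' (x + θ * Complex.I)) 1 + 1
      ≤ Real.exp ((2 + |θ|) * errBound m L * Real.exp (-x / 2)) := by
  have := dev_segment_le_of_re hm hlam h (x : ℂ) (θ * Complex.I) hx (by simp) (by simp)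
    fun t ht => ?_
  · refine this.trans ?_
    have hn : ‖(θ : ℂ) * Complex.I‖ = |θ| := by simp
    rw [hn]
    refine (mul_le_mul_of_nonneg_right (hreal x hx) (Real.exp_pos _).le).trans (le_of_eq ?_)
    rw [← Real.exp_add]; congr 1; ring
  · have e := re_mul_exp m 0 θ x (t * θ)
    rw [Complex.ofReal_zero, zero_add, Complex.ofReal_mul, mul_assoc (t : ℂ)] at e
    rw [e, zero_mul, zero_sub]
    refine mul_nonpos_of_nonneg_of_nonpos (Real.exp_pos _).le (neg_nonpos.2 ?_)
    have habs : ((m : ℝ) + 2) / 2 * (t * |θ|) ≤ Real.pi := by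
      refine le_trans ?_ hθ
      have : t * |θ| ≤ |θ| := mul_le_of_le_one_left (abs_nonneg θ) ht.2
      gcongr
    have hsin : 0 ≤ Real.sin (((m : ℝ) + 2) / 2 * (t * |θ|)) :=
      Real.sin_nonneg_of_nonneg_of_le_pi
        (mul_nonneg (by positivity) (mul_nonneg ht.1 (abs_nonneg θ))) habs
    rcases abs_cases θ with ⟨h1, h2⟩ | ⟨h1, h2⟩
    · rw [h1] at hsin
      exact mul_nonneg h2 hsin
    · rw [h1, mul_neg, mul_neg, Real.sin_neg] at hsin
      exact mul_nonneg_of_nonpos_of_nonpos h2.le (by linarith)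

lemma inv_sin_mul_cos_le_sin {ε φ : ℝ} (hε : 0 < ε) (h1 : Real.pi ≤ φ)
    (h2 : φ ≤ 3 * Real.pi / 2 - ε) : |1 / Real.sin ε| * Real.cos φ ≤ Real.sin φ := by
  have hs : 0 < Real.sin ε := Real.sin_pos_of_pos_of_lt_pi hε (by linarith [Real.pi_pos])
  have hc : Real.cos φ = -Real.sin (3 * Real.pi / 2 - φ) := by
    rw [show 3 * Real.pi / 2 - φ = Real.pi + (Real.pi / 2 - φ) by ring, Real.sin_add,
      Real.sin_pi, Real.cos_pi, Real.sin_pi_div_two_sub]; ring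
  have hs' : Real.sin φ = -Real.cos (3 * Real.pi / 2 - φ) := by
    rw [show 3 * Real.pi / 2 - φ = Real.pi + (Real.pi / 2 - φ) by ring, Real.cos_add,
      Real.sin_pi, Real.cos_pi, Real.cos_pi_div_two_sub]; ring
  have hmono : Real.sin ε ≤ Real.sin (3 * Real.pi / 2 - φ) :=
    Real.sin_le_sin_of_le_of_le_pi_div_two (by linarith) (by linarith) (by linarith)
  rw [abs_of_pos (by positivity), hc, hs']
  have h3 : 1 ≤ 1 / Real.sin ε * Real.sin (3 * Real.pi / 2 - φ) := by
    rw [one_div, inv_mul_eq_div, one_le_div hs]; exact hmono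
  have := Real.cos_le_one (3 * Real.pi / 2 - φ)
  linarith

/-- The amplitudes are `(1, 0) + O(z ^ (-1 / 2))` in `|arg z| ≤ 3 π / (m + 2) - ε`. A point with
`|arg z| ≥ 2 π / (m + 2)` is reached from the boundary of the region of `dev_arc_le` by a
logarithmic spiral, a segment of slope `1 / κ` in the variable `w = log z`. -/
lemma exists_sector_bound {m : ℕ} (hm : 3 ≤ m) {L : ℝ} (hL : 0 ≤ L) {ε : ℝ} (hε : 0 < ε) :
    ∃ K X : ℝ, 0 ≤ K ∧ 0 ≤ X ∧ ∀ (lam : ℂ) (y y' : ℂ → ℂ), ‖lam‖ ≤ L → IsSol m lam y y' →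
      (∀ x : ℝ, 0 ≤ x → dev (ampP m y y' x) (ampR m y y' x) 1 + 1
        ≤ Real.exp (2 * errBound m L * Real.exp (-x / 2))) →
      ∀ w : ℂ, X ≤ w.re → |w.im| ≤ 3 * Real.pi / ((m : ℝ) + 2) - ε →
        dev (ampP m y y' w) (ampR m y y' w) 1 ≤ K * Real.exp (-w.re / 2) := by
  have hb := errBound_nonneg m hL
  set n : ℝ := ((m : ℝ) + 2) / 2 with hn
  have hn0 : 0 < n := by positivity
  set κ : ℝ := |1 / Real.sin (n * ε)| with hκ
  have hκ0 : 0 ≤ κ := abs_nonneg _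
  set T : ℝ := 3 * Real.pi / ((m : ℝ) + 2) with hT
  have hT0 : 0 < T := by positivity
  have hnT : n * T = 3 * Real.pi / 2 := by rw [hn, hT]; field_simp
  set b := errBound m L with hbdef
  set K₁ : ℝ := (2 + T + (κ + 1) * T) * b * Real.exp (κ * T / 2) with hK₁
  have hK₁0 : 0 ≤ K₁ := by positivity
  refine ⟨K₁ * Real.exp K₁, κ * T, by positivity, by positivity, ?_⟩
  intro lam y y' hlam h hreal w hX hw
  set x := w.re with hx
  set θ := |w.im| with hθ
  have hθ0 : 0 ≤ θ := abs_nonneg _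
  have hx0 : 0 ≤ x := le_trans (by positivity) hX
  have hθT : θ ≤ T := by linarith
  -- it is enough to bound the deviation by an exponential of a small exponent
  suffices hmain : dev (ampP m y y' w) (ampR m y y' w) 1 + 1
      ≤ Real.exp (K₁ * Real.exp (-x / 2)) by
    set u := K₁ * Real.exp (-x / 2) with hu
    have hu1 : u ≤ K₁ := mul_le_of_le_one_right hK₁0 (Real.exp_le_one_iff.2 (by linarith))
    have hu0 : 0 ≤ u := by positivity
    have h1 : Real.exp u - 1 ≤ u * Real.exp u := by
      have := mul_le_mul_of_nonneg_right (Real.add_one_le_exp (-u)) (Real.exp_pos u).le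
      rw [← Real.exp_add, neg_add_cancel, Real.exp_zero] at this
      linarith
    calc dev (ampP m y y' w) (ampR m y y' w) 1 ≤ Real.exp u - 1 := by linarith
      _ ≤ u * Real.exp u := h1
      _ ≤ u * Real.exp K₁ := by gcongr
      _ = K₁ * Real.exp K₁ * Real.exp (-x / 2) := by rw [hu]; ring
  have hexp1 : 1 ≤ Real.exp (κ * T / 2) := Real.one_le_exp (by positivity)
  by_cases hcase : n * θ ≤ Real.pi
  · have h1 := dev_arc_le hm hlam h hreal hx0 (θ := w.im) hcase
    rw [hx, Complex.re_add_im] at h1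
    refine h1.trans (Real.exp_le_exp.2 ?_)
    refine mul_le_mul_of_nonneg_right ?_ (Real.exp_pos _).le
    rw [hK₁]
    have h2 : (2 + θ) * b ≤ (2 + T + (κ + 1) * T) * b := by
      have : 0 ≤ (κ + 1) * T := by positivity
      exact mul_le_mul_of_nonneg_right (by linarith) hb
    exact h2.trans (le_mul_of_one_le_right (by positivity) hexp1)
  · push Not at hcase
    obtain ⟨s, hs2, hs⟩ : ∃ s : ℝ, s ^ 2 = 1 ∧ w.im = s * θ := by
      rcases abs_cases w.im with ⟨h1, _⟩ | ⟨h1, _⟩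
      · exact ⟨1, by norm_num, by rw [hθ, h1]; ring⟩
      · exact ⟨-1, by norm_num, by rw [hθ, h1]; ring⟩
    have hsabs : |s| = 1 := by
      rw [← sq_eq_sq₀ (abs_nonneg s) zero_le_one, sq_abs, hs2, one_pow]
    set θ₁ : ℝ := Real.pi / n with hθ₁
    have hnθ₁ : n * θ₁ = Real.pi := by rw [hθ₁]; field_simp
    have hθ₁0 : 0 < θ₁ := by positivity
    set δ := θ - θ₁ with hδ
    have hδ0 : 0 ≤ δ := by
      have : n * θ₁ ≤ n * θ := by rw [hnθ₁]; exact hcase.le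
      linarith [le_of_mul_le_mul_left this hn0]
    have hδT : δ ≤ T := by linarith
    set x₁ := x - κ * δ with hx₁
    have hx₁X : x - κ * T ≤ x₁ := by
      have : κ * δ ≤ κ * T := by gcongr
      linarith
    have hx₁0 : 0 ≤ x₁ := by linarith
    have hx₁x : x₁ ≤ x := by
      have : 0 ≤ κ * δ := by positivity
      linarith
    have habs₁ : |s * θ₁| = θ₁ := by rw [abs_mul, hsabs, one_mul, abs_of_pos hθ₁0]
    have h1 := dev_arc_le hm hlam h hreal hx₁0 (θ := s * θ₁)
      (by rw [habs₁, ← hn, hnθ₁])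
    rw [habs₁] at h1
    set d : ℂ := ((κ * δ : ℝ) : ℂ) + ((s * δ : ℝ) : ℂ) * Complex.I with hd
    have hwd : ((x₁ : ℂ) + ((s * θ₁ : ℝ) : ℂ) * Complex.I) + d = w := by
      apply Complex.ext
      · simp [hd, hx₁, hx]
      · simp [hd, hs, hδ]; ring
    have hdn : ‖d‖ ≤ (κ + 1) * T := by
      calc ‖d‖ ≤ ‖((κ * δ : ℝ) : ℂ)‖ + ‖((s * δ : ℝ) : ℂ) * Complex.I‖ := norm_add_le _ _
        _ = κ * δ + δ := by
            rw [norm_mul, Complex.norm_I, mul_one, Complex.norm_real, Complex.norm_real,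
              Real.norm_eq_abs, Real.norm_eq_abs, abs_mul s, hsabs, one_mul, abs_of_nonneg hδ0,
              abs_of_nonneg (by positivity)]
        _ ≤ (κ + 1) * T := by nlinarith
    have h2 := dev_segment_le_of_re hm hlam h ((x₁ : ℂ) + ((s * θ₁ : ℝ) : ℂ) * Complex.I) d hx₁0
      (by simp) (by rw [hwd]; exact hx₁x) fun t ht => ?_
    · rw [hwd] at h2
      refine h2.trans ((mul_le_mul_of_nonneg_right h1 (Real.exp_pos _).le).trans ?_)
      rw [← Real.exp_add]
      refine Real.exp_le_exp.2 ?_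
      have hx₁e : Real.exp (-x₁ / 2) ≤ Real.exp (κ * T / 2) * Real.exp (-x / 2) := by
        rw [← Real.exp_add]; exact Real.exp_le_exp.2 (by linarith)
      have hθ₁T : θ₁ ≤ T := by linarith
      calc (2 + θ₁) * b * Real.exp (-x₁ / 2) + ‖d‖ * (b * Real.exp (-x₁ / 2))
          = (2 + θ₁ + ‖d‖) * b * Real.exp (-x₁ / 2) := by ring
        _ ≤ (2 + T + (κ + 1) * T) * b * (Real.exp (κ * T / 2) * Real.exp (-x / 2)) := by gcongr
        _ = K₁ * Real.exp (-x / 2) := by rw [hK₁]; ring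
    · have e : (x₁ : ℂ) + ((s * θ₁ : ℝ) : ℂ) * Complex.I + t * d
          = ((x₁ + t * (κ * δ) : ℝ) : ℂ) + ((s * (θ₁ + t * δ) : ℝ) : ℂ) * Complex.I := by
        rw [hd]; push_cast; ring
      rw [e, hd, re_mul_exp]
      refine mul_nonpos_of_nonneg_of_nonpos (Real.exp_pos _).le ?_
      have hφ1 : Real.pi ≤ n * (θ₁ + t * δ) := by
        rw [mul_add, hnθ₁]
        have : 0 ≤ n * (t * δ) := mul_nonneg hn0.le (mul_nonneg ht.1 hδ0)
        linarith
      have hφ2 : n * (θ₁ + t * δ) ≤ 3 * Real.pi / 2 - n * ε := by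
        rw [← hnT, ← mul_sub]
        have : t * δ ≤ δ := mul_le_of_le_one_left hδ0 ht.2
        refine mul_le_mul_of_nonneg_left ?_ hn0.le
        linarith
      have htrig := inv_sin_mul_cos_le_sin (mul_pos hn0 hε) hφ1 hφ2
      have hss : s = 1 ∨ s = -1 := sq_eq_one_iff.1 hs2
      have hcs : Real.cos (n * (s * (θ₁ + t * δ))) = Real.cos (n * (θ₁ + t * δ)) ∧
          s * Real.sin (n * (s * (θ₁ + t * δ))) = Real.sin (n * (θ₁ + t * δ)) := by
        rcases hss with rfl | rfl
        · simp
        · constructor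
          · rw [neg_one_mul, mul_neg, Real.cos_neg]
          · rw [neg_one_mul (θ₁ + t * δ), mul_neg, Real.sin_neg]; ring
      rw [← hn, hcs.1]
      calc κ * δ * Real.cos (n * (θ₁ + t * δ)) - s * δ * Real.sin (n * (s * (θ₁ + t * δ)))
          = δ * (κ * Real.cos (n * (θ₁ + t * δ)) - s * Real.sin (n * (s * (θ₁ + t * δ)))) := by ring
        _ ≤ 0 := by
            rw [hcs.2]
            exact mul_nonpos_of_nonneg_of_nonpos hδ0 (by linarith)

/-! ### Existence of the subdominant solution -/

lemma cpow_neg_quarter (m : ℕ) {z : ℂ} (hz : z ≠ 0) :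
    z ^ (-(m : ℂ) / 4) = (quarterPow m (Complex.log z))⁻¹ := by
  rw [Complex.cpow_def_of_ne_zero hz, quarterPow, ← Complex.exp_neg]; congr 1; ring

lemma cpow_quarter (m : ℕ) {z : ℂ} (hz : z ≠ 0) :
    z ^ ((m : ℂ) / 4) = quarterPow m (Complex.log z) := by
  rw [Complex.cpow_def_of_ne_zero hz, quarterPow, mul_comm]

lemma expFactor_eq (m : ℕ) {z : ℂ} (hz : z ≠ 0) :
    expFactor m z = Complex.exp (-phase m (Complex.log z)) := by
  rw [expFactor, Complex.cpow_def_of_ne_zero hz, phase, mul_comm (Complex.log z), neg_mul]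

lemma norm_add_sub_one_le (P R : ℂ) : ‖P + R - 1‖ ≤ 2 * dev P R 1 := by
  have h1 := norm_sub_le_dev P R 1
  have h2 := norm_le_dev P R 1
  calc ‖P + R - 1‖ = ‖(P - 1) + R‖ := by congr 1; ring
    _ ≤ ‖P - 1‖ + ‖R‖ := norm_add_le _ _
    _ ≤ 2 * dev P R 1 := by linarith

lemma norm_sub_sub_one_le (P R : ℂ) : ‖P - R - 1‖ ≤ 2 * dev P R 1 := by
  simpa [dev, sub_eq_add_neg] using norm_add_sub_one_le P (-R)

theorem exists_isSubdominantSolution {m : ℕ} (hm : 3 ≤ m) : ∃ f, IsSubdominantSolution m f := by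
  obtain ⟨f, f', hf, hsol, hreal⟩ := exists_sol_real hm
  have hderiv : ∀ lam, deriv (fun w => f w lam) = fun z => f' z lam := fun lam =>
    funext fun z => (hsol lam z).1.deriv
  have hbound : ∀ ε : ℝ, 0 < ε → ∀ K : Set ℂ, IsCompact K → ∃ C R : ℝ, 0 ≤ C ∧ 1 ≤ R ∧
      ∀ lam ∈ K, ∀ z : ℂ, R ≤ ‖z‖ → |Complex.arg z| ≤ 3 * Real.pi / ((m : ℝ) + 2) - ε →
        dev (ampP m (fun z => f z lam) (fun z => f' z lam) (Complex.log z))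
          (ampR m (fun z => f z lam) (fun z => f' z lam) (Complex.log z)) 1
          ≤ C * ‖z‖ ^ (-(1 / 2) : ℝ) := by
    intro ε hε K hK
    obtain ⟨L, hL⟩ := hK.isBounded.exists_norm_le
    obtain ⟨C, X, hC, hX, h⟩ := exists_sector_bound hm (abs_nonneg L) hε
    refine ⟨C, Real.exp X, hC, Real.one_le_exp hX, fun lam hlam z hz harg => ?_⟩
    have hlam' : ‖lam‖ ≤ |L| := (hL lam hlam).trans (le_abs_self L)
    have hz0 : 0 < ‖z‖ := (Real.exp_pos X).trans_le hz
    have := h lam _ _ hlam' (hsol lam) (hreal |L| lam hlam') (Complex.log z)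
      (by rw [Complex.log_re]; exact (Real.le_log_iff_exp_le hz0).2 hz)
      (by rwa [Complex.log_im])
    rw [Complex.log_re] at this
    convert this using 2
    rw [Real.rpow_def_of_pos hz0]; congr 1; ring
  refine ⟨f, hf, fun lam z => ?_, fun ε hε K hK => ?_, fun ε hε K hK => ?_⟩
  · rw [hderiv, (hsol lam z).2.deriv]; ring
  · obtain ⟨C, R, hC, hR, h⟩ := hbound ε hε K hK
    refine ⟨2 * C, R, by linarith, fun lam hlam z hz harg => ?_⟩
    have hz0 : z ≠ 0 := norm_pos_iff.1 (by linarith)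
    have hrep := apply_exp_eq m (fun z => f z lam) (fun z => f' z lam) (Complex.log z)
    rw [Complex.exp_log hz0] at hrep
    rw [hrep, cpow_neg_quarter m hz0, expFactor_eq m hz0, mul_div_assoc, div_self, mul_one]
    · refine (norm_add_sub_one_le _ _).trans ?_
      linarith [h lam hlam z hz harg]
    · exact mul_ne_zero (inv_ne_zero (quarterPow_ne_zero _ _)) (Complex.exp_ne_zero _)
  · obtain ⟨C, R, hC, hR, h⟩ := hbound ε hε K hK
    refine ⟨2 * C + (m : ℝ) / 4 * (2 * C + 1), R, by linarith, fun lam hlam z hz harg => ?_⟩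
    have hz1 : 1 ≤ ‖z‖ := hR.trans hz
    have hz0 : z ≠ 0 := norm_pos_iff.1 (by linarith)
    have hrep := deriv_apply_exp_eq m (fun z => f z lam) (fun z => f' z lam) (Complex.log z)
    have hD := h lam hlam z hz harg
    have hsum := norm_add_sub_one_le
      (ampP m (fun z => f z lam) (fun z => f' z lam) (Complex.log z))
      (ampR m (fun z => f z lam) (fun z => f' z lam) (Complex.log z))
    have hdiff := norm_sub_sub_one_le
      (ampP m (fun z => f z lam) (fun z => f' z lam) (Complex.log z))
      (ampR m (fun z => f z lam) (fun z => f' z lam) (Complex.log z))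
    have hq : ‖quarterPow m (Complex.log z) ^ 2 * z‖ = ‖z‖ ^ ((m : ℝ) / 2 + 1) := by
      rw [norm_mul, norm_pow, norm_quarterPow, ← Real.exp_nat_mul, Complex.log_re,
        Real.rpow_add (by linarith), Real.rpow_one, Real.rpow_def_of_pos (by linarith)]
      congr 2; push_cast; ring
    rw [Complex.exp_log hz0] at hrep
    rw [show deriv (fun w => f w lam) z = f' z lam from congrFun (hderiv lam) z, hrep,
      cpow_quarter m hz0, expFactor_eq m hz0, mul_div_assoc, div_self, mul_one]
    · set P := ampP m (fun z => f z lam) (fun z => f' z lam) (Complex.log z)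
      set Q := ampR m (fun z => f z lam) (fun z => f' z lam) (Complex.log z)
      set r := ‖z‖ ^ (-(1 / 2) : ℝ) with hr
      have hr1 : r ≤ 1 := Real.rpow_le_one_of_one_le_of_nonpos hz1 (by norm_num)
      have hr0 : 0 ≤ r := by positivity
      have hPQ : ‖P + Q‖ ≤ 2 * C + 1 := by
        have h1 : ‖P + Q‖ ≤ ‖P + Q - 1‖ + ‖(1 : ℂ)‖ := by
          simpa using norm_add_le (P + Q - 1) 1
        rw [norm_one] at h1
        have : C * r ≤ C := mul_le_of_le_one_right hC hr1
        linarith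
      have hinv : ‖(m : ℂ) / 4 * (P + Q) / (quarterPow m (Complex.log z) ^ 2 * z)‖
          ≤ (m : ℝ) / 4 * (2 * C + 1) * r := by
        have hm4 : ‖(m : ℂ) / 4‖ = (m : ℝ) / 4 := by simp
        rw [norm_div, hq, norm_mul, hm4, div_eq_mul_inv, ← Real.rpow_neg (by linarith)]
        have : ‖z‖ ^ (-((m : ℝ) / 2 + 1)) ≤ r := by
          rw [hr]
          refine Real.rpow_le_rpow_of_exponent_le hz1 ?_
          have : (0 : ℝ) ≤ m := by positivity
          linarith
        gcongr
      calc _ = ‖(P - Q - 1) + (m : ℂ) / 4 * (P + Q) / (quarterPow m (Complex.log z) ^ 2 * z)‖ := by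
            congr 1; ring
        _ ≤ 2 * (C * r) + (m : ℝ) / 4 * (2 * C + 1) * r :=
            (norm_add_le _ _).trans (add_le_add (by linarith) hinv)
        _ = (2 * C + (m : ℝ) / 4 * (2 * C + 1)) * r := by ring
    · exact mul_ne_zero (neg_ne_zero.2 (quarterPow_ne_zero _ _)) (Complex.exp_ne_zero _)

lemma isSubdominantSolution_sol {m : ℕ} (hm : 3 ≤ m) : IsSubdominantSolution m (sol m) :=
  Classical.epsilon_spec (exists_isSubdominantSolution hm)

/-! ### The Wronskian of neighbouring solutions -/

lemma omega_ne_zero (m : ℕ) : omega m ≠ 0 := Complex.exp_ne_zero _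

lemma omega_pow (m : ℕ) : omega m ^ (m + 2) = 1 := by
  have h2 : (m : ℂ) + 2 ≠ 0 := by exact_mod_cast (m + 1).succ_ne_zero
  rw [omega, ← Complex.exp_nat_mul, ← Complex.exp_two_pi_mul_I]
  congr 1; push_cast; field_simp

lemma log_omega {m : ℕ} (hm : 3 ≤ m) :
    Complex.log (omega m) = 2 * (Real.pi : ℂ) * Complex.I / ((m : ℂ) + 2) := by
  have hm2 : (0 : ℝ) < (m : ℝ) + 2 := by positivity
  have e : 2 * (Real.pi : ℂ) * Complex.I / ((m : ℂ) + 2)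
      = ((2 * Real.pi / ((m : ℝ) + 2) : ℝ) : ℂ) * Complex.I := by push_cast; ring
  have him : (2 * (Real.pi : ℂ) * Complex.I / ((m : ℂ) + 2)).im = 2 * Real.pi / ((m : ℝ) + 2) := by
    rw [e, Complex.im_ofReal_mul, Complex.I_im, mul_one]
  have hpos : 0 < 2 * Real.pi / ((m : ℝ) + 2) := by positivity
  rw [omega, Complex.log_exp]
  · rw [him]; linarith [Real.pi_pos]
  · rw [him, div_le_iff₀ hm2]
    have : (3 : ℝ) ≤ m := by exact_mod_cast hm
    nlinarith [Real.pi_pos]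

lemma IsSubdominantSolution.isSol {m : ℕ} {f : ℂ → ℂ → ℂ} (hf : IsSubdominantSolution m f)
    (lam : ℂ) : IsSol m lam (fun z => f z lam) (deriv fun z => f z lam) := by
  have hd : Differentiable ℂ fun z => f z lam :=
    hf.entire.comp (differentiable_id.prodMk (differentiable_const lam))
  have hd' : Differentiable ℂ (deriv fun z => f z lam) := fun z =>
    (hd.analyticAt z).deriv.differentiableAt
  refine fun z => ⟨(hd z).hasDerivAt, (hd' z).hasDerivAt.congr_deriv ?_⟩
  linear_combination -hf.ode lam z

/-- Rotating `z` by a root of unity `c` with `c ^ (m + 2) = 1` and `lam` by `c ^ m` preserves the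
equation. -/
lemma IsSol.rotate {m : ℕ} {lam c : ℂ} (hc : c ^ (m + 2) = 1) {y y' : ℂ → ℂ}
    (h : IsSol m (c ^ m * lam) y y') :
    IsSol m lam (fun z => y (c * z)) (fun z => c * y' (c * z)) := by
  have hline : ∀ z, HasDerivAt (fun z : ℂ => c * z) c z := fun z => by
    simpa using (hasDerivAt_id z).const_mul c
  refine fun z => ⟨((h (c * z)).1.comp z (hline z)).congr_deriv (mul_comm _ _), ?_⟩
  refine (((h (c * z)).2.comp z (hline z)).const_mul c).congr_deriv ?_
  rw [mul_pow]
  linear_combination (z ^ m + lam) * y (c * z) * hc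

/-- The asymptotics of a subdominant solution along the ray `arg z = θ`, in the variable
`log z`. -/
lemma IsSubdominantSolution.tendsto_ray {m : ℕ} (hm : 3 ≤ m) {f : ℂ → ℂ → ℂ}
    (hf : IsSubdominantSolution m f) (lam : ℂ) {θ : ℝ} (hθ : |θ| ≤ 2 * Real.pi / ((m : ℝ) + 2)) :
    Tendsto (fun x : ℝ => f (Complex.exp (x + θ * Complex.I)) lam
      * (quarterPow m (x + θ * Complex.I) * Complex.exp (phase m (x + θ * Complex.I))))
      atTop (𝓝 1) ∧
    Tendsto (fun x : ℝ => deriv (fun z => f z lam) (Complex.exp (x + θ * Complex.I))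
      * (-(quarterPow m (x + θ * Complex.I))⁻¹ * Complex.exp (phase m (x + θ * Complex.I))))
      atTop (𝓝 1) := by
  have hm2 : (0 : ℝ) < (m : ℝ) + 2 := by positivity
  have hpi := Real.pi_pos
  have hθpi : |θ| < Real.pi := hθ.trans_lt <| by
    rw [div_lt_iff₀ hm2]
    have : (3 : ℝ) ≤ m := by exact_mod_cast hm
    nlinarith
  have hsec : |θ| ≤ 3 * Real.pi / ((m : ℝ) + 2) - Real.pi / ((m : ℝ) + 2) :=
    hθ.trans (le_of_eq (by ring))
  have hlog : ∀ x : ℝ, Complex.log (Complex.exp (x + θ * Complex.I)) = x + θ * Complex.I :=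
    fun x => Complex.log_exp (by simpa using (abs_lt.1 hθpi).1) (by simpa using (abs_lt.1 hθpi).2.le)
  have hnorm : ∀ x : ℝ, ‖Complex.exp (x + θ * Complex.I)‖ = Real.exp x := fun x => by
    rw [Complex.norm_exp]; simp
  have harg : ∀ x : ℝ, Complex.arg (Complex.exp (x + θ * Complex.I)) = θ := fun x => by
    rw [← Complex.log_im, hlog]; simp
  have hsmall : ∀ C : ℝ, Tendsto (fun x : ℝ => C * Real.exp x ^ (-(1 / 2) : ℝ)) atTop (𝓝 0) := by
    intro C
    simpa using ((tendsto_rpow_neg_atTop (by norm_num : (0 : ℝ) < 1 / 2)).comp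
      Real.tendsto_exp_atTop).const_mul C
  obtain ⟨C, R, hR, h⟩ := hf.asymp (Real.pi / ((m : ℝ) + 2)) (by positivity) {lam}
    isCompact_singleton
  obtain ⟨C', R', hR', h'⟩ := hf.asymp_deriv (Real.pi / ((m : ℝ) + 2)) (by positivity) {lam}
    isCompact_singleton
  constructor
  · rw [tendsto_iff_norm_sub_tendsto_zero]
    refine squeeze_zero' (Eventually.of_forall fun _ => norm_nonneg _) ?_ (hsmall C)
    filter_upwards [eventually_ge_atTop (Real.log R)] with x hx
    have := h lam rfl (Complex.exp (x + θ * Complex.I))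
      (by rw [hnorm]; exact (Real.log_le_iff_le_exp hR).1 hx) (by rwa [harg])
    rw [cpow_neg_quarter m (Complex.exp_ne_zero _), expFactor_eq m (Complex.exp_ne_zero _), hlog,
      hnorm, Complex.exp_neg, ← mul_inv, div_inv_eq_mul] at this
    exact this
  · rw [tendsto_iff_norm_sub_tendsto_zero]
    refine squeeze_zero' (Eventually.of_forall fun _ => norm_nonneg _) ?_ (hsmall C')
    filter_upwards [eventually_ge_atTop (Real.log R')] with x hx
    have := h' lam rfl (Complex.exp (x + θ * Complex.I))
      (by rw [hnorm]; exact (Real.log_le_iff_le_exp hR').1 hx) (by rwa [harg])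
    rw [cpow_quarter m (Complex.exp_ne_zero _), expFactor_eq m (Complex.exp_ne_zero _), hlog,
      hnorm, Complex.exp_neg, div_eq_mul_inv, mul_inv, inv_inv, inv_neg] at this
    exact this

/-- The Wronskian of `f (z, lam)` and `f (ω⁻¹ z, ω⁻ᵐ lam)`, read off along the ray
`arg z = π / (m + 2)`, on which `arg (ω⁻¹ z) = -π / (m + 2)` and the two exponential factors
cancel. -/
lemma IsSubdominantSolution.wronskian_neighbour {m : ℕ} (hm : 3 ≤ m) {f : ℂ → ℂ → ℂ}
    (hf : IsSubdominantSolution m f) (lam z : ℂ) :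
    f z lam * ((omega m)⁻¹
        * deriv (fun w => f w ((omega m)⁻¹ ^ m * lam)) ((omega m)⁻¹ * z))
      - deriv (fun w => f w lam) z * f ((omega m)⁻¹ * z) ((omega m)⁻¹ ^ m * lam)
      = -2 * (omega m)⁻¹ * (Complex.exp ((m : ℂ) / 4 * Complex.log (omega m)))⁻¹ := by
  have hm2 : (m : ℂ) + 2 ≠ 0 := by exact_mod_cast (m + 1).succ_ne_zero
  set μ := (omega m)⁻¹ ^ m * lam with hμ
  set θ : ℝ := Real.pi / ((m : ℝ) + 2) with hθ
  set q := Complex.exp ((m : ℂ) / 4 * Complex.log (omega m)) with hq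
  have hθ0 : 0 < θ := by positivity
  have hθle : θ ≤ 2 * Real.pi / ((m : ℝ) + 2) := by
    rw [hθ]; gcongr; linarith [Real.pi_pos]
  have hω := omega_ne_zero m
  have hq0 : q ≠ 0 := Complex.exp_ne_zero _
  have hlogω : Complex.log (omega m) = 2 * θ * Complex.I := by
    rw [log_omega hm, hθ]; push_cast; ring
  have hθm : ((m : ℂ) + 2) * θ = Real.pi := by rw [hθ]; push_cast; field_simp
  have hqq : q * q = -(omega m)⁻¹ := by
    rw [hq, ← Complex.exp_add, ← Complex.exp_log hω, ← Complex.exp_neg, Complex.exp_log hω]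
    rw [← mul_one (Complex.exp (-_)), ← mul_neg, ← Complex.exp_pi_mul_I, ← Complex.exp_add, hlogω,
      ← hθm]
    congr 1; ring
  have h0 := hf.tendsto_ray hm lam (θ := θ) (by rwa [abs_of_pos hθ0])
  have h1 := hf.tendsto_ray hm μ (θ := -θ) (by rwa [abs_neg, abs_of_pos hθ0])
  have hsol := (hf.isSol lam).wronskian_const
    ((hf.isSol μ).rotate (c := (omega m)⁻¹) (by rw [inv_pow, omega_pow, inv_one]))
  have hrot : ∀ x : ℝ, (omega m)⁻¹ * Complex.exp (x + θ * Complex.I)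
      = Complex.exp (x + ((-θ : ℝ) : ℂ) * Complex.I) := fun x => by
    rw [← Complex.exp_log hω, ← Complex.exp_neg, ← Complex.exp_add, hlogω]
    congr 1; push_cast; ring
  have hphase : ∀ x : ℝ, phase m (x + ((-θ : ℝ) : ℂ) * Complex.I)
      = -phase m (x + θ * Complex.I) := fun x => by
    have e : ((m : ℂ) + 2) / 2 * (x + θ * Complex.I)
        = ((m : ℂ) + 2) / 2 * (x + ((-θ : ℝ) : ℂ) * Complex.I) + Real.pi * Complex.I := by
      rw [← hθm]; push_cast; ring
    rw [phase, phase, e, Complex.exp_add, Complex.exp_pi_mul_I]; ring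
  have hquarter : ∀ x : ℝ, quarterPow m (x + θ * Complex.I)
      = quarterPow m (x + ((-θ : ℝ) : ℂ) * Complex.I) * q := fun x => by
    rw [quarterPow, quarterPow, hq, ← Complex.exp_add, hlogω]
    congr 1; push_cast; ring
  have hlim := ((h0.1.mul h1.2).const_mul (-(omega m)⁻¹ * q⁻¹)).add
    ((h0.2.mul h1.1).const_mul q)
  have hconst : ∀ x : ℝ, -(omega m)⁻¹ * q⁻¹
        * ((f (Complex.exp (x + θ * Complex.I)) lam
            * (quarterPow m (x + θ * Complex.I) * Complex.exp (phase m (x + θ * Complex.I))))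
          * (deriv (fun z => f z μ) (Complex.exp (x + ((-θ : ℝ) : ℂ) * Complex.I))
            * (-(quarterPow m (x + ((-θ : ℝ) : ℂ) * Complex.I))⁻¹
              * Complex.exp (phase m (x + ((-θ : ℝ) : ℂ) * Complex.I)))))
      + q * ((deriv (fun z => f z lam) (Complex.exp (x + θ * Complex.I))
            * (-(quarterPow m (x + θ * Complex.I))⁻¹
              * Complex.exp (phase m (x + θ * Complex.I))))
          * (f (Complex.exp (x + ((-θ : ℝ) : ℂ) * Complex.I)) μ
            * (quarterPow m (x + ((-θ : ℝ) : ℂ) * Complex.I)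
              * Complex.exp (phase m (x + ((-θ : ℝ) : ℂ) * Complex.I)))))
      = f z lam * ((omega m)⁻¹ * deriv (fun w => f w μ) ((omega m)⁻¹ * z))
        - deriv (fun w => f w lam) z * f ((omega m)⁻¹ * z) μ := fun x => by
    rw [hsol z (Complex.exp (x + θ * Complex.I)), hrot, hphase, hquarter, Complex.exp_neg]
    have hE := quarterPow_ne_zero m (x + ((-θ : ℝ) : ℂ) * Complex.I)
    have hS := Complex.exp_ne_zero (phase m (x + θ * Complex.I))
    generalize quarterPow m (x + ((-θ : ℝ) : ℂ) * Complex.I) = E at hE ⊢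
    generalize Complex.exp (phase m (x + θ * Complex.I)) = S at hS ⊢
    generalize Complex.exp (x + θ * Complex.I) = a
    generalize Complex.exp (x + ((-θ : ℝ) : ℂ) * Complex.I) = b
    field_simp
    ring
  rw [funext hconst] at hlim
  rw [tendsto_nhds_unique tendsto_const_nhds hlim]
  field_simp
  have hqq' : q * q * omega m = -1 := by rw [hqq]; field_simp
  linear_combination hqq'

lemma deriv_rotSol (m : ℕ) (k : ℤ) (lam z : ℂ) :
    deriv (fun w => rotSol m k w lam) z = omega m ^ (-k)
      * deriv (fun w => sol m w (omega m ^ (-(m : ℤ) * k) * lam)) (omega m ^ (-k) * z) := by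
  have := deriv_comp_mul_left (omega m ^ (-k))
    (fun w => sol m w (omega m ^ (-(m : ℤ) * k) * lam)) z
  simpa [rotSol] using this

end Subdominant

end

theorem lemma2p3 (m : ℕ) (hm : 3 ≤ m) (k : ℤ) (lam z : ℂ) :
    Subdominant.wronskian m k (k + 1) z lam
      = -2 * Subdominant.omega m ^ (-(m : ℂ) / 4 - (k : ℂ) - 1) := by
  open Subdominant in
  have hω := omega_ne_zero m
  have hW := (isSubdominantSolution_sol hm).wronskian_neighbour hm
    (omega m ^ (-(m : ℤ) * k) * lam) (omega m ^ (-k) * z)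
  have hz : omega m ^ (-(k + 1)) = (omega m)⁻¹ * omega m ^ (-k) := by
    rw [neg_add, zpow_add₀ hω, zpow_neg_one, mul_comm]
  have hlam : omega m ^ (-(m : ℤ) * (k + 1)) = (omega m)⁻¹ ^ m * omega m ^ (-(m : ℤ) * k) := by
    rw [mul_add, zpow_add₀ hω, mul_one, mul_comm, inv_pow, zpow_neg, zpow_natCast]
  have hpow : omega m ^ (-(m : ℂ) / 4 - (k : ℂ) - 1) = omega m ^ (-k) * ((omega m)⁻¹
      * (Complex.exp ((m : ℂ) / 4 * Complex.log (omega m)))⁻¹) := by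
    rw [Complex.cpow_sub _ _ hω, Complex.cpow_sub _ _ hω, Complex.cpow_one, Complex.cpow_intCast,
      Complex.cpow_def_of_ne_zero hω, ← Complex.exp_neg, zpow_neg]
    rw [show Complex.log (omega m) * (-(m : ℂ) / 4) = -((m : ℂ) / 4 * Complex.log (omega m)) by
      ring]
    field_simp
  rw [wronskian, deriv_rotSol, deriv_rotSol, hpow]
  simp only [rotSol, hz, hlam, mul_assoc] at hW ⊢
  linear_combination omega m ^ (-k) * hW
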